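/- Theorem 1.1. Let $d \in \mathbb{N} = \{1,2,3,\dots\}$, $\delta \in (0,\infty)$, $T, L \in [0,\infty)$, $\Theta = \bigcup_{n=1}^{\infty} \mathbb{Z}^n$, $X \in C([0,T],\mathbb{R}^d)$, $\xi \in \mathbb{R}^d$, let $\|\cdot\|$ be an arbitrary norm on $\mathbb{R}^d$, let $(S,\mathcal{S})$ be a measurable space, let $F\colon \mathbb{R}^d \times S \to \mathbb{R}^d$ be $(\mathcal{B}(\mathbb{R}^d)\otimes\mathcal{S})/\mathcal{B}(\mathbb{R}^d)$-measurable, and assume that $\|F(x,s)-F(y,s)\| \le L\|x-y\|$ for all $x,y \in \mathbb{R}^d$, $s \in S$. Let $(\Omega,\mathcal{F},\mathbb{P})$ be a probability space, let $Z^\theta\colon\Omega\to S$, $\theta\in\Theta$, be i.i.d. random variables, assume that $\mathbb{E}[\|F(\xi,Z^0)\|^2]<\infty$, and assume for all $t\in[0,T]$ that $X(t)=\xi+\int_0^t \mathbb{E}[F(X(r),Z^0)]\,dr$. Let $\mathfrak{r}^\theta\colon\Omega\to[0,1]$, $\theta\in\Theta$, be independent random variables that are uniformly distributed on $[0,1]$,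 and assume that $(\mathfrak{r}^\theta)_{\theta\in\Theta}$ and $(Z^\theta)_{\theta\in\Theta}$ are independent. For $\theta \in \mathbb{Z}^j$ and $l,k\in\mathbb{Z}$ write $(\theta,l,k)\in\mathbb{Z}^{j+2}\subseteq\Theta$. Let $\mathcal{X}_{n,m}^\theta\colon[0,T]\times\Omega\to\mathbb{R}^d$, $n,m\in\mathbb{N}_0$, $\theta\in\Theta$, satisfy for all $n\in\mathbb{N}_0$, $m\in\mathbb{N}$, $\theta\in\Theta$, $t\in[0,T]$ that $$\mathcal{X}_{n,m}^{\theta}(t) = \Bigg[\sum_{l=1}^{n-1}\frac{t}{m^{n-l}}\sum_{k=1}^{m^{n-l}} \Big( F\big(\mathcal{X}_{l,m}^{(\theta,l,k)}(\mathfrak{r}^{(\theta,l,k)}t),Z^{(\theta,l,k)}\big)-F\big(\mathcal{X}_{l-1,m}^{(\theta,l,-k)}(\mathfrak{r}^{(\theta,l,k)}t),Z^{(\theta,l,k)}\big)\Big)\Bigg] + \Bigg[\frac{t\,\mathbb{1}_{\mathbb{N}}(n)}{m^n}\sum_{k=1}^{m^n}F\big(\xi,Z^{(\theta,0,k)}\big)\Bigg]+\xi.$$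 For $n,m\in\mathbb{N}$ let $RV_{n,m}$ be the number of realizations of the random variables $(Z^\theta)_{\theta\in\Theta}$ which are used to compute one realization of $\mathcal{X}_{n,m}^0(T)$ through this recursion. That is, $RV_{n,m}$ is the number of elements of $U_{n,m}^{0}$, where $U_{0,m}^\theta=\emptyset$ and, for $n \ge 1$, $$U_{n,m}^\theta = \{(\theta,0,k) : 1\le k\le m^n\}\cup\bigcup_{l=1}^{n-1}\bigcup_{k=1}^{m^{n-l}}\Big(\{(\theta,l,k)\}\cup U_{l,m}^{(\theta,l,k)}\cup U_{l-1,m}^{(\theta,l,-k)}\Big).$$ Then there exist $c\in\mathbb{R}$ and $N=(N_\varepsilon)_{\varepsilon\in(0,1]}\colon(0,1]\to\mathbb{N}$ such that for all $\varepsilon\in(0,1]$ it holds that $RV_{N_\varepsilon,N_\varepsilon}\le c\,\varepsilon^{-(2+\delta)}$ and $\big(\mathbb{E}[\|X(T)-\mathcal{X}_{N_\varepsilon,N_\varepsilon}^0(T)\|^2]\big)^{1/2}\le\varepsilon$. -/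

import Mathlib

/-- The index set `Θ = ⋃_{n ≥ 1} ℤⁿ`: nonempty finite sequences of integers. -/
abbrev MLPIndex : Type := {θ : List ℤ // θ ≠ []}

namespace MLPIndex

/-- The index `0 ∈ ℤ¹ ⊆ Θ`. -/
def zero : MLPIndex := ⟨[0], by simp⟩

/-- The index `(θ, l, k) ∈ ℤⁿ⁺²` for `θ ∈ ℤⁿ` and `l, k ∈ ℤ`. -/
def child (θ : MLPIndex) (l k : ℤ) : MLPIndex := ⟨θ.1 ++ [l, k], by simp⟩

end MLPIndex

/-- `mlpIndices m n θ` is the set of all `ϑ ∈ Θ` such that the random variable `Z^ϑ` is used when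
`𝒳_{n,m}^θ(t)` is computed through its defining recursion. Nothing is used for `n = 0`. For
`n ≥ 1` these are: the indices `(θ,0,k)` with `1 ≤ k ≤ mⁿ`; and, for `1 ≤ l ≤ n-1` and
`1 ≤ k ≤ m^(n-l)`, the index `(θ,l,k)`, everything used to compute `𝒳_{l,m}^{(θ,l,k)}`, and
everything used to compute `𝒳_{l-1,m}^{(θ,l,-k)}`. -/
def mlpIndices (m : ℕ) : ℕ → MLPIndex → Finset MLPIndex
  | 0, _ => ∅
  | n + 1, θ =>
    ((Finset.Icc 1 (m ^ (n + 1))).image fun k : ℕ => θ.child 0 (k : ℤ)) ∪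
      (Finset.Icc 1 n).attach.biUnion fun l =>
        (Finset.Icc 1 (m ^ (n + 1 - (l : ℕ)))).biUnion fun k : ℕ =>
          {θ.child ((l : ℕ) : ℤ) (k : ℤ)} ∪
            (mlpIndices m (l : ℕ) (θ.child ((l : ℕ) : ℤ) (k : ℤ)) ∪
              mlpIndices m ((l : ℕ) - 1) (θ.child ((l : ℕ) : ℤ) (-(k : ℤ))))
  termination_by n => n
  decreasing_by
    · have := Finset.mem_Icc.1 l.2
      omega
    · have := Finset.mem_Icc.1 l.2
      omega

/-- `RV_{n,m}`: the number of realizations of the random variables `(Z^θ)_{θ ∈ Θ}` which are used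
to compute one realization of `𝒳_{n,m}^0(T)`. -/
def mlpRV (n m : ℕ) : ℕ := (mlpIndices m n MLPIndex.zero).card

/-!
The approximation `𝒳_{n,m}^θ(t)` is a deterministic function `mlpField` of the noise `(𝔯, Z)` at the
indices that extend `θ`. The noise seen from any index has the same product law `noiseMeasure`, so
the analysis takes place on one product space, in which subtrees with disjoint indices are
independent. As all norms on `ℝᵈ` are equivalent, the Euclidean norm may be used.

Let `e_n(t)` be the mean squared error at level `n`. The level corrections telescope in mean, so the
bias of level `n` is `t` times the mean error of the integrand at level `n - 1`, taken at a random
time `r t`. The summands are pairwise independent, so their variances add up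
(`integral_norm_sub_sum_sq_le`), and the level `l` correction, averaged over `m ^ (n - l)` samples,
has a variance bounded through `e_l` and `e_{l-1}`. This gives a recursion
(`integral_norm_mlpField_sub_sq_le`) in which every earlier error appears under `∫₀ᵗ`, with
weights of order `m ^ (l + 1 - n)`. Inserting `e_l(t) ≤ A (6 / m) ^ l exp (κ m t)` reproduces this
bound at level `n`, because `∫₀ᵗ exp (κ m s) ds ≤ exp (κ m t) / (κ m)` regains a factor `m`
(`exists_mlpField_error_bound`).

For `n = m = N` the squared error is `A (6 exp (κ T) / N) ^ N`, whereas the cost is at most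
`(4 N) ^ N` (`card_mlpIndices_le`). Up to geometric factors the cost is the inverse of the squared
error, and a power `N ^ (δ N / 2)` absorbs all geometric factors (`exists_levels`).
-/

open MeasureTheory ProbabilityTheory Set Filter Topology

/-! ### Indices -/

namespace MLPIndex

/-- The concatenation `(q, p)` of two indices. -/
def append (q p : MLPIndex) : MLPIndex := ⟨q.1 ++ p.1, by simp [p.2]⟩

/-- The index `(l, k) ∈ ℤ²`. -/
def node (l k : ℤ) : MLPIndex := ⟨[l, k], by simp⟩

lemma append_injective (q : MLPIndex) : Function.Injective q.append := by
  intro p p' h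
  simpa [append, Subtype.ext_iff] using h

lemma append_node (θ : MLPIndex) (l k : ℤ) : θ.append (node l k) = θ.child l k := rfl

lemma append_append (q p r : MLPIndex) : q.append (p.append r) = (q.append p).append r := by
  simp [append]

lemma append_ne_node (l k l' k' : ℤ) (p : MLPIndex) : (node l k).append p ≠ node l' k' := by
  intro h
  have := congrArg (fun x : MLPIndex => x.1.length) h
  simp [append, node] at this
  exact p.2 this

lemma append_node_ne {l k l' k' : ℤ} (h : (l, k) ≠ (l', k')) (p p' : MLPIndex) :
    (node l k).append p ≠ (node l' k').append p' := by
  intro h'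
  simp [append, node, Subtype.ext_iff] at h' h
  exact h h'.1 h'.2.1

end MLPIndex

/-! ### Independence in product measures -/

section ProductMeasure

variable {I J K : Type*} {A : Type*} [MeasurableSpace A] {μ : Measure A} [IsProbabilityMeasure μ]

/-- Coordinates of a product measure read along two maps with disjoint ranges are independent. -/
lemma indepFun_comp_infinitePi {f : J → I} {g : K → I} (h : ∀ j k, f j ≠ g k) :
    IndepFun (fun (w : I → A) j => w (f j)) (fun w k => w (g k))
      (Measure.infinitePi fun _ : I => μ) := by
  have hi : iIndepFun (fun (i : I) (w : I → A) => w i) (Measure.infinitePi fun _ : I => μ) :=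
    iIndepFun_infinitePi (X := fun _ x => x) (fun _ => measurable_id)
  have hle : ∀ i : I, MeasurableSpace.comap (fun w : I → A => w i) inferInstance ≤
      (inferInstance : MeasurableSpace (I → A)) := fun i => (measurable_pi_apply i).comap_le
  have hd : Disjoint (range f) (range g) := by
    rw [Set.disjoint_left]
    rintro _ ⟨j, rfl⟩ ⟨k, hk⟩
    exact h j k hk.symm
  have key := indep_iSup_of_disjoint hle hi.iIndep hd
  refine indep_of_indep_of_le key ?_ ?_
  all_goals
    rw [MeasurableSpace.pi, MeasurableSpace.comap_iSup]
    refine iSup_le fun j => ?_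
    rw [MeasurableSpace.comap_comp]
    exact le_iSup₂_of_le (_) (mem_range_self j) le_rfl

lemma measurePreserving_comp_infinitePi {f : J → I} (hf : Function.Injective f) :
    MeasurePreserving (fun (w : I → A) j => w (f j)) (Measure.infinitePi fun _ : I => μ)
      (Measure.infinitePi fun _ : J => μ) :=
  ⟨by fun_prop, Measure.map_infinitePi_infinitePi_of_inj (P := fun _ : I => μ) hf⟩

/-- One coordinate together with a family of other coordinates has a product law. -/
lemma measurePreserving_eval_comp_infinitePi {f : J → I} (hf : Function.Injective f) {i : I}
    (hi : ∀ j, f j ≠ i) :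
    MeasurePreserving (fun w : I → A => (w i, fun j => w (f j)))
      (Measure.infinitePi fun _ : I => μ) (μ.prod (Measure.infinitePi fun _ : J => μ)) := by
  refine ⟨by fun_prop, ?_⟩
  have h1 := indepFun_comp_infinitePi (μ := μ) (f := fun _ : Unit => i) (g := f)
    (fun _ k => (hi k).symm)
  have h2 : IndepFun (fun w : I → A => w i) (fun w j => w (f j))
      (Measure.infinitePi fun _ : I => μ) :=
    h1.comp (φ := fun w : Unit → A => w ()) (ψ := id) (measurable_pi_apply ()) measurable_id
  rw [(indepFun_iff_map_prod_eq_prod_map_map (measurable_pi_apply i).aemeasurable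
    (measurable_pi_lambda _ fun _ => measurable_pi_apply _).aemeasurable).1 h2,
    Measure.infinitePi_map_eval, (measurePreserving_comp_infinitePi hf).map_eq]

end ProductMeasure

section IndepPairs

variable {I Ω A B : Type*} [MeasurableSpace Ω] [MeasurableSpace A] [MeasurableSpace B]
  {P : Measure Ω}

/-- If `U` and `V` are independent families of independent variables, then the pairs `(U i, V i)`
are independent. -/
lemma iIndepFun.prodMk_of_indepFun [IsProbabilityMeasure P] {U : I → Ω → A} {V : I → Ω → B}
    (hUm : ∀ i, Measurable (U i)) (hVm : ∀ i, Measurable (V i))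
    (hU : iIndepFun U P) (hV : iIndepFun V P)
    (hUV : IndepFun (fun ω i => U i ω) (fun ω i => V i ω) P) :
    iIndepFun (fun i ω => (U i ω, V i ω)) P := by
  have hm : ∀ i, Measurable fun ω => (U i ω, V i ω) := fun i => (hUm i).prodMk (hVm i)
  rw [iIndepFun_iff_iIndep]
  let π : I → Set (Set Ω) := fun i =>
    preimage (fun ω => (U i ω, V i ω)) '' image2 (· ×ˢ ·) {s | MeasurableSet s} {t | MeasurableSet t}
  refine iIndepSets.iIndep (m := fun i => MeasurableSpace.comap (fun ω => (U i ω, V i ω)) inferInstance)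
    (fun i => (hm i).comap_le) π (fun i => isPiSystem_prod.comap _) (fun i => ?_) ?_
  · simp only [π]
    rw [← generateFrom_prod, MeasurableSpace.comap_generateFrom]
  · rw [iIndepSets_iff]
    intro s f hf
    classical
    have hf' : ∀ i, ∃ a : Set A, ∃ b : Set B, MeasurableSet a ∧ MeasurableSet b ∧
        (i ∈ s → f i = U i ⁻¹' a ∩ V i ⁻¹' b) := by
      intro i
      by_cases hi : i ∈ s
      · obtain ⟨_, ⟨a, ha, b, hb, rfl⟩, h⟩ := hf i hi
        exact ⟨a, b, ha, hb, fun _ => h.symm⟩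
      · exact ⟨∅, ∅, .empty, .empty, fun h => absurd h hi⟩
    choose a b ha hb hab using hf'
    have hinter : ⋂ i ∈ s, f i = (⋂ i ∈ s, U i ⁻¹' a i) ∩ ⋂ i ∈ s, V i ⁻¹' b i := by
      rw [iInter₂_congr hab]
      simp only [iInter_inter_distrib]
    have hprod : P ((⋂ i ∈ s, U i ⁻¹' a i) ∩ ⋂ i ∈ s, V i ⁻¹' b i) =
        P (⋂ i ∈ s, U i ⁻¹' a i) * P (⋂ i ∈ s, V i ⁻¹' b i) := by
      have h := hUV.measure_inter_preimage_eq_mul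
        (⋂ i ∈ s, (fun u : I → A => u i) ⁻¹' a i) (⋂ i ∈ s, (fun v : I → B => v i) ⁻¹' b i)
        (Finset.measurableSet_biInter s fun i _ => measurable_pi_apply i (ha i))
        (Finset.measurableSet_biInter s fun i _ => measurable_pi_apply i (hb i))
      simpa only [preimage_iInter, ← preimage_comp, Function.comp_def] using h
    rw [hinter, hprod, hU.measure_inter_preimage_eq_mul s fun i _ => ha i,
      hV.measure_inter_preimage_eq_mul s fun i _ => hb i, ← Finset.prod_mul_distrib]
    refine Finset.prod_congr rfl fun i hi => ?_
    have hi2 : IndepFun (U i) (V i) P :=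
      hUV.comp (φ := fun u : I → A => u i) (ψ := fun v : I → B => v i)
        (measurable_pi_apply i) (measurable_pi_apply i)
    rw [hab i hi, hi2.measure_inter_preimage_eq_mul _ _ (ha i) (hb i)]

end IndepPairs

/-! ### Sums of independent vectors -/

/-- Bias-variance bound in `ℝᵈ` for sums of pairwise independent vectors. -/
lemma integral_norm_sub_sum_sq_le {d : ℕ} {Ω ι : Type*} [MeasurableSpace Ω] {Q : Measure Ω}
    [IsProbabilityMeasure Q] (s : Finset ι) {Y : ι → Ω → EuclideanSpace ℝ (Fin d)}
    (hY : ∀ i ∈ s, MemLp (Y i) 2 Q)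
    (hind : (s : Set ι).Pairwise fun i j => IndepFun (Y i) (Y j) Q)
    (x : EuclideanSpace ℝ (Fin d)) :
    ∫ ω, ‖x - ∑ i ∈ s, Y i ω‖ ^ 2 ∂Q ≤
      ‖x - ∑ i ∈ s, ∫ ω, Y i ω ∂Q‖ ^ 2 + ∑ i ∈ s, ∫ ω, ‖Y i ω‖ ^ 2 ∂Q := by
  have hc : ∀ j, ∀ i ∈ s, MemLp (fun ω => Y i ω j) 2 Q := fun j i hi =>
    (EuclideanSpace.proj (𝕜 := ℝ) j).comp_memLp' (hY i hi)
  have hS : ∀ j, MemLp (fun ω => ∑ i ∈ s, Y i ω j) 2 Q := fun j =>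
    memLp_finsetSum s (hc j)
  have hcoord : ∀ j, ∫ ω, (x j - ∑ i ∈ s, Y i ω j) ^ 2 ∂Q ≤
      (x j - ∑ i ∈ s, ∫ ω, Y i ω j ∂Q) ^ 2 + ∑ i ∈ s, ∫ ω, (Y i ω j) ^ 2 ∂Q := by
    intro j
    set U : Ω → ℝ := ∑ i ∈ s, fun ω => Y i ω j with hU
    have hUe : ∀ ω, U ω = ∑ i ∈ s, Y i ω j := fun ω => by simp [hU]
    have hUm : MemLp U 2 Q := by
      have : U = fun ω => ∑ i ∈ s, Y i ω j := funext hUe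
      rw [this]; exact hS j
    have hmean : ∫ ω, U ω ∂Q = ∑ i ∈ s, ∫ ω, Y i ω j ∂Q := by
      simp_rw [hUe]
      exact integral_finsetSum s fun i hi => (hc j i hi).integrable (by norm_num)
    have hvar : variance U Q = ∑ i ∈ s, variance (fun ω => Y i ω j) Q :=
      IndepFun.variance_sum (hc j) fun i hi i' hi' hne =>
        (hind hi hi' hne).comp (φ := fun y : EuclideanSpace ℝ (Fin d) => y j)
          (ψ := fun y : EuclideanSpace ℝ (Fin d) => y j) (by fun_prop) (by fun_prop)
    have hle : variance U Q ≤ ∑ i ∈ s, ∫ ω, (Y i ω j) ^ 2 ∂Q := by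
      rw [hvar]
      refine Finset.sum_le_sum fun i hi => ?_
      rw [variance_eq_sub (hc j i hi)]
      have := sq_nonneg (∫ ω, Y i ω j ∂Q)
      simp only [Pi.pow_apply]
      linarith
    have hU1 : Integrable U Q := hUm.integrable (by norm_num)
    have hU2 : Integrable (fun ω => U ω ^ 2) Q := hUm.integrable_sq
    have hexp : ∫ ω, (x j - ∑ i ∈ s, Y i ω j) ^ 2 ∂Q =
        (x j - ∫ ω, U ω ∂Q) ^ 2 + variance U Q := by
      rw [variance_eq_sub hUm]
      have : ∀ ω, (x j - ∑ i ∈ s, Y i ω j) ^ 2 = (x j ^ 2 - 2 * x j * U ω) + U ω ^ 2 := by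
        intro ω; rw [← hUe]; ring
      simp_rw [this]
      have hU3 : Integrable (fun ω => x j ^ 2 - 2 * x j * U ω) Q :=
        (integrable_const _).sub (hU1.const_mul _)
      rw [integral_add hU3 hU2, integral_sub (integrable_const _) (hU1.const_mul _),
        integral_const_mul]
      simp
      ring
    rw [hexp, hmean]
    linarith
  have hint : ∀ i ∈ s, ∀ j, (∫ ω, Y i ω ∂Q) j = ∫ ω, Y i ω j ∂Q := fun i hi j =>
    ((EuclideanSpace.proj (𝕜 := ℝ) j).integral_comp_comm
      ((hY i hi).integrable (by norm_num))).symm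
  simp_rw [EuclideanSpace.norm_sq_eq, Real.norm_eq_abs, sq_abs]
  rw [integral_finsetSum]
  swap
  · intro j _
    have := ((memLp_const (x j)).sub (hS j)).integrable_sq
    refine this.congr (.of_forall fun ω => ?_)
    simp
  have h2 : ∑ i ∈ s, ∫ ω, ∑ j, (Y i ω j) ^ 2 ∂Q = ∑ j, ∑ i ∈ s, ∫ ω, (Y i ω j) ^ 2 ∂Q := by
    rw [Finset.sum_comm]
    exact Finset.sum_congr rfl fun i hi => integral_finsetSum _ fun j _ => (hc j i hi).integrable_sq
  rw [h2, ← Finset.sum_add_distrib]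
  refine Finset.sum_le_sum fun j _ => ?_
  have h3 : (x - ∑ i ∈ s, ∫ ω, Y i ω ∂Q) j = x j - ∑ i ∈ s, ∫ ω, Y i ω j ∂Q := by
    simp only [PiLp.sub_apply, WithLp.ofLp_sum, Finset.sum_apply]
    rw [Finset.sum_congr rfl fun i hi => hint i hi j]
  rw [h3]
  refine le_trans (le_of_eq ?_) (hcoord j)
  simp

/-! ### The approximation as a function of the noise -/

/-- The noise seen from the index `q`: `shift q w p = w (q, p)`. -/
def MLPIndex.shift {A : Type*} (q : MLPIndex) (w : MLPIndex → A) : MLPIndex → A :=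
  fun p => w (q.append p)

lemma MLPIndex.measurable_shift {A : Type*} [MeasurableSpace A] (q : MLPIndex) :
    Measurable (q.shift : (MLPIndex → A) → MLPIndex → A) :=
  measurable_pi_lambda _ fun _ => measurable_pi_apply _

section

variable {d : ℕ} {S : Type*}

/-- The approximation `𝒳_{n,m}^θ(t)` as a deterministic function of the noise seen from `θ`. The term
with `F(ξ, Z)` is the summand `l = 0`, because level `0` is the constant `ξ`; it is therefore
written as a level correction without a lower level. -/
noncomputable def mlpField (F : EuclideanSpace ℝ (Fin d) → S → EuclideanSpace ℝ (Fin d))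
    (ξ : EuclideanSpace ℝ (Fin d)) (m : ℕ) :
    ℕ → ℝ → (MLPIndex → unitInterval × S) → EuclideanSpace ℝ (Fin d)
  | n, t, w => ξ + ∑ l : Fin n, ∑ k ∈ Finset.Icc 1 (m ^ (n - (l : ℕ))),
      (t / (m : ℝ) ^ (n - (l : ℕ))) •
        (F (mlpField F ξ m l (((w (.node l k)).1 : ℝ) * t) ((MLPIndex.node l k).shift w))
            (w (.node l k)).2 -
          if (l : ℕ) = 0 then 0 else
            F (mlpField F ξ m ((l : ℕ) - 1) (((w (.node l k)).1 : ℝ) * t)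
              ((MLPIndex.node l (-(k : ℤ))).shift w)) (w (.node l k)).2)
  termination_by n => n
  decreasing_by
    · exact l.2
    · have := l.2
      omega

variable (F : EuclideanSpace ℝ (Fin d) → S → EuclideanSpace ℝ (Fin d))
  (ξ : EuclideanSpace ℝ (Fin d)) (m : ℕ)

/-- The integrand `F(𝒳_l(r t), s)` at the noise `z = (r, s)`, where `𝒳_l` is built from `w`. -/
noncomputable def mlpTerm (t : ℝ) (l : ℕ) (z : unitInterval × S)
    (w : MLPIndex → unitInterval × S) : EuclideanSpace ℝ (Fin d) :=
  F (mlpField F ξ m l ((z.1 : ℝ) * t) w) z.2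

/-- The `k`-th summand of the recursion at level `l`. The subtracted lower level sees the noise below
`(l, -k)`, but uses the random time and the variable `Z` at `(l, k)`. -/
noncomputable def mlpDiff (t : ℝ) (l k : ℕ) (w : MLPIndex → unitInterval × S) :
    EuclideanSpace ℝ (Fin d) :=
  mlpTerm F ξ m t l (w (.node l k)) ((MLPIndex.node l k).shift w) -
    if l = 0 then 0 else
      mlpTerm F ξ m t (l - 1) (w (.node l k)) ((MLPIndex.node l (-(k : ℤ))).shift w)

lemma mlpField_eq (n : ℕ) (t : ℝ) (w : MLPIndex → unitInterval × S) :
    mlpField F ξ m n t w = ξ + ∑ l ∈ Finset.range n, ∑ k ∈ Finset.Icc 1 (m ^ (n - l)),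
      (t / (m : ℝ) ^ (n - l)) • mlpDiff F ξ m t l k w := by
  rw [mlpField]
  congr 1
  exact Fin.sum_univ_eq_sum_range (fun l => ∑ k ∈ Finset.Icc 1 (m ^ (n - l)),
      (t / (m : ℝ) ^ (n - l)) • mlpDiff F ξ m t l k w) n

@[simp] lemma mlpField_zero (t : ℝ) (w : MLPIndex → unitInterval × S) :
    mlpField F ξ m 0 t w = ξ := by
  simp [mlpField_eq]

variable [MeasurableSpace S] {F}

lemma measurable_mlpField (hF : Measurable (Function.uncurry F)) (n : ℕ) :
    Measurable fun p : ℝ × (MLPIndex → unitInterval × S) => mlpField F ξ m n p.1 p.2 := by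
  induction n using Nat.strong_induction_on with
  | _ n ih =>
    have key : ∀ l k k' : ℤ, ∀ j < n, Measurable
        fun p : ℝ × (MLPIndex → unitInterval × S) =>
          mlpTerm F ξ m p.1 j (p.2 (.node l k)) ((MLPIndex.node l k').shift p.2) := by
      intro l k k' j hj
      have hw : Measurable fun p : ℝ × (MLPIndex → unitInterval × S) => p.2 (.node l k) :=
        (measurable_pi_apply _).comp measurable_snd
      refine hF.comp (Measurable.prodMk ((ih j hj).comp (Measurable.prodMk
        ((measurable_subtype_coe.comp (measurable_fst.comp hw)).mul measurable_fst)
        ((MLPIndex.measurable_shift _).comp measurable_snd))) (measurable_snd.comp hw))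
    simp_rw [mlpField_eq]
    refine measurable_const.add (Finset.measurable_fun_sum _ fun l hl =>
      Finset.measurable_fun_sum _ fun k _ => ?_)
    have hl' := Finset.mem_range.1 hl
    refine (measurable_fst.div_const _).smul ?_
    unfold mlpDiff
    split_ifs with h
    · simpa using key l k k l hl'
    · exact (key l k k l hl').sub (key l k _ (l - 1) (by omega))

lemma measurable_mlpTerm (hF : Measurable (Function.uncurry F)) (t : ℝ) (l : ℕ) :
    Measurable fun p : (unitInterval × S) × (MLPIndex → unitInterval × S) =>
      mlpTerm F ξ m t l p.1 p.2 :=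
  hF.comp (Measurable.prodMk ((measurable_mlpField ξ m hF l).comp (Measurable.prodMk
    ((measurable_subtype_coe.comp (measurable_fst.comp measurable_fst)).mul_const t)
    measurable_snd)) (measurable_snd.comp measurable_fst))

end

/-! ### The error recursion -/

section UnitIntervalIntegrals

lemma integral_unitInterval_eq {E : Type*} [NormedAddCommGroup E] [NormedSpace ℝ E] (f : ℝ → E) :
    ∫ r : unitInterval, f r = ∫ r in (0 : ℝ)..1, f r := by
  rw [unitInterval.measurePreserving_coe.integral_comp unitInterval.measurableEmbedding_coe,
    intervalIntegral.integral_of_le zero_le_one, integral_Icc_eq_integral_Ioc]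

lemma smul_integral_unitInterval_eq {E : Type*} [NormedAddCommGroup E] [NormedSpace ℝ E]
    (f : ℝ → E) (t : ℝ) :
    t • ∫ r : unitInterval, f (r * t) = ∫ r in (0 : ℝ)..t, f r := by
  rw [integral_unitInterval_eq (fun r => f (r * t)), intervalIntegral.smul_integral_comp_mul_right]
  simp

/-- Averaging `exp (c s)` over `s ∈ [0, t]` gains the factor `1 / c` that makes the error recursion
contract. -/
lemma mul_integral_exp_le {c t : ℝ} (hc : 0 < c) :
    t * ∫ r : unitInterval, Real.exp (c * (r * t)) ≤ Real.exp (c * t) / c := by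
  have h := smul_integral_unitInterval_eq (fun r => Real.exp (c * r)) t
  rw [smul_eq_mul] at h
  rw [h, le_div_iff₀ hc, mul_comm, intervalIntegral.mul_integral_comp_mul_left, integral_exp]
  simp

end UnitIntervalIntegrals

section L2

variable {Ω E : Type*} [MeasurableSpace Ω] {Q : Measure Ω} [NormedAddCommGroup E]

lemma lintegral_enorm_sq_eq {f : Ω → E} (hf : MemLp f 2 Q) :
    ∫⁻ ω, ‖f ω‖ₑ ^ 2 ∂Q = ENNReal.ofReal (∫ ω, ‖f ω‖ ^ 2 ∂Q) := by
  rw [ofReal_integral_eq_lintegral_ofReal hf.norm.integrable_sq (.of_forall fun _ => sq_nonneg _)]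
  refine lintegral_congr fun ω => ?_
  rw [ENNReal.ofReal_pow (norm_nonneg _), ofReal_norm]

lemma memLp_two_of_lintegral_le {f : Ω → E} (hf : AEStronglyMeasurable f Q) {K : ℝ} (hK : 0 ≤ K)
    (h : ∫⁻ ω, ‖f ω‖ₑ ^ 2 ∂Q ≤ ENNReal.ofReal K) :
    MemLp f 2 Q ∧ ∫ ω, ‖f ω‖ ^ 2 ∂Q ≤ K := by
  have hf2 : MemLp f 2 Q := by
    refine ⟨hf, (eLpNorm_lt_top_iff_lintegral_rpow_enorm_lt_top two_ne_zero (by simp)).2 ?_⟩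
    simpa using h.trans_lt ENNReal.ofReal_lt_top
  refine ⟨hf2, ?_⟩
  rwa [lintegral_enorm_sq_eq hf2, ENNReal.ofReal_le_ofReal_iff hK] at h

lemma norm_integral_sq_le [NormedSpace ℝ E] [IsProbabilityMeasure Q] {f : Ω → E}
    (hf : MemLp f 2 Q) : ‖∫ ω, f ω ∂Q‖ ^ 2 ≤ ∫ ω, ‖f ω‖ ^ 2 ∂Q := by
  have h := variance_nonneg (fun ω => ‖f ω‖) Q
  rw [variance_eq_sub hf.norm] at h
  have h2 := norm_integral_le_integral_norm (μ := Q) f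
  have h3 : ‖∫ ω, f ω ∂Q‖ ^ 2 ≤ (∫ ω, ‖f ω‖ ∂Q) ^ 2 := by gcongr
  simp only [Pi.pow_apply] at h
  linarith

end L2

section Recursion

variable {d : ℕ} {S : Type*} [MeasurableSpace S]
  {F : EuclideanSpace ℝ (Fin d) → S → EuclideanSpace ℝ (Fin d)}

/-- The law of the noise: at every index an independent pair of a uniform variable on `[0,1]` and a
variable with law `ν`. -/
noncomputable def noiseMeasure (ν : Measure S) : Measure (MLPIndex → unitInterval × S) :=
  Measure.infinitePi fun _ => (volume : Measure unitInterval).prod ν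

/-- The joint law of the noise `(𝔯, Z)` at one index and of the noise at all indices below another
one. -/
noncomputable abbrev stepMeasure (ν : Measure S) :
    Measure ((unitInterval × S) × (MLPIndex → unitInterval × S)) :=
  ((volume : Measure unitInterval).prod ν).prod (noiseMeasure ν)

variable {ν : Measure S} [IsProbabilityMeasure ν]

instance : IsProbabilityMeasure (noiseMeasure ν) := by unfold noiseMeasure; infer_instance

/-- The noise at `(l, k)` has the right law and is independent of everything that is used by an
approximation at `(l, k')`. The case `k' = k` is not excluded: an approximation at an index uses
only noise at strictly longer indices. -/
lemma measurePreserving_node_shift (l k k' : ℤ) :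
    MeasurePreserving (fun w : MLPIndex → unitInterval × S =>
      (w (.node l k), (MLPIndex.node l k').shift w)) (noiseMeasure ν)
      (stepMeasure ν) :=
  measurePreserving_eval_comp_infinitePi (MLPIndex.append_injective _)
    fun p => MLPIndex.append_ne_node l k' l k p

variable {ξ : EuclideanSpace ℝ (Fin d)} {m : ℕ}

/-- Distinct summands of the recursion use noise at disjoint sets of indices. The positivity of `k`
and `k'` keeps the indices `(l, k)` apart from the indices `(l, -k')`. -/
lemma indepFun_mlpDiff (hF : Measurable (Function.uncurry F)) (t : ℝ) {l k l' k' : ℕ}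
    (hk : 1 ≤ k) (hk' : 1 ≤ k') (h : (l, k) ≠ (l', k')) :
    IndepFun (mlpDiff F ξ m t l k) (mlpDiff F ξ m t l' k') (noiseMeasure ν) := by
  -- `f l k` lists the indices whose noise enters `mlpDiff F ξ m t l k`
  let f : ℕ → ℕ → Unit ⊕ (Bool × MLPIndex) → MLPIndex := fun l k =>
    Sum.elim (fun _ => .node l k)
      (fun p => if p.1 then (MLPIndex.node l k).append p.2 else (MLPIndex.node l (-(k : ℤ))).append p.2)
  have hdisj : ∀ i j, f l k i ≠ f l' k' j := by
    have h0 : ∀ {a b : ℤ}, (a = k ∨ a = -(k : ℤ)) → (b = k' ∨ b = -(k' : ℤ)) →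
        ((l : ℤ), a) ≠ ((l' : ℤ), b) := by
      intro a b ha hb hab
      simp only [ne_eq, Prod.mk.injEq, not_and] at h hab
      omega
    rintro (_ | ⟨_ | _, p⟩) (_ | ⟨_ | _, p'⟩)
    · intro he
      refine h0 (.inl rfl) (.inl rfl) ?_
      simpa [f, MLPIndex.node] using he
    · exact (MLPIndex.append_ne_node _ _ _ _ _).symm
    · exact (MLPIndex.append_ne_node _ _ _ _ _).symm
    · exact MLPIndex.append_ne_node _ _ _ _ _
    · exact MLPIndex.append_node_ne (h0 (.inr rfl) (.inr rfl)) _ _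
    · exact MLPIndex.append_node_ne (h0 (.inr rfl) (.inl rfl)) _ _
    · exact MLPIndex.append_ne_node _ _ _ _ _
    · exact MLPIndex.append_node_ne (h0 (.inl rfl) (.inr rfl)) _ _
    · exact MLPIndex.append_node_ne (h0 (.inl rfl) (.inl rfl)) _ _
  let H : ℕ → (Unit ⊕ (Bool × MLPIndex) → unitInterval × S) → EuclideanSpace ℝ (Fin d) := fun l v =>
    mlpTerm F ξ m t l (v (.inl ())) (fun p => v (.inr (true, p))) -
      if l = 0 then 0 else mlpTerm F ξ m t (l - 1) (v (.inl ())) (fun p => v (.inr (false, p)))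
  have hH : ∀ l, Measurable (H l) := by
    intro l
    have hg : ∀ (b : Bool) (j : ℕ), Measurable
        fun v : Unit ⊕ (Bool × MLPIndex) → unitInterval × S =>
          mlpTerm F ξ m t j (v (.inl ())) (fun p => v (.inr (b, p))) := fun b j =>
      (measurable_mlpTerm ξ m hF t j).comp (Measurable.prodMk (measurable_pi_apply _)
        (measurable_pi_lambda _ fun _ => measurable_pi_apply _))
    simp only [H]
    split_ifs
    · simpa using hg true l
    · exact (hg true l).sub (hg false _)
  exact (indepFun_comp_infinitePi (μ := (volume : Measure unitInterval).prod ν) hdisj).comp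
    (hH l) (hH l')

variable {L : ℝ} {X : ℝ → EuclideanSpace ℝ (Fin d)} {T : ℝ}

lemma exists_norm_sub_le (hX : Continuous X) (ξ : EuclideanSpace ℝ (Fin d)) (a b : ℝ) :
    ∃ K, 0 ≤ K ∧ ∀ r ∈ Icc a b, ‖X r - ξ‖ ≤ K := by
  obtain ⟨K, hK⟩ := (isCompact_Icc (a := a) (b := b)).exists_bound_of_continuousOn
    (f := fun r => X r - ξ) (by fun_prop)
  exact ⟨max K 0, le_max_right _ _, fun r hr => (hK r hr).trans (le_max_left _ _)⟩

lemma unitInterval_mul_mem {t : ℝ} (ht : 0 ≤ t) (r : unitInterval) : (r : ℝ) * t ∈ Icc 0 t :=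
  ⟨mul_nonneg r.2.1 ht, mul_le_of_le_one_left ht r.2.2⟩

lemma measurable_exact (hF : Measurable (Function.uncurry F)) (hX : Continuous X) (t : ℝ) :
    Measurable fun z : unitInterval × S => F (X (z.1 * t)) z.2 :=
  hF.comp (Measurable.prodMk (hX.measurable.comp
    ((measurable_subtype_coe.comp measurable_fst).mul_const t)) measurable_snd)

lemma memLp_exact (hF : Measurable (Function.uncurry F))
    (hLip : ∀ x y s, ‖F x s - F y s‖ ≤ L * ‖x - y‖) (hL : 0 ≤ L) (hM : MemLp (F ξ) 2 ν)
    (hX : Continuous X) {t : ℝ} (ht : 0 ≤ t) :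
    MemLp (fun z : unitInterval × S => F (X (z.1 * t)) z.2) 2
      ((volume : Measure unitInterval).prod ν) := by
  obtain ⟨K, hK0, hK⟩ := exists_norm_sub_le hX ξ 0 t
  have h1 : MemLp (fun z : unitInterval × S => ‖F ξ z.2‖ + L * K) 2
      ((volume : Measure unitInterval).prod ν) :=
    (hM.comp_snd (volume : Measure unitInterval)).norm.add (memLp_const _)
  refine h1.mono' (measurable_exact hF hX t).aestronglyMeasurable (.of_forall fun z => ?_)
  have h2 := hLip (X (z.1 * t)) ξ z.2
  have h3 := hK _ (unitInterval_mul_mem ht z.1)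
  have h4 := norm_le_norm_add_norm_sub' (F (X (z.1 * t)) z.2) (F ξ z.2)
  have h5 : L * ‖X (z.1 * t) - ξ‖ ≤ L * K := by gcongr
  linarith

/-- The integral equation with the time integral written as a mean over a uniform variable. -/
lemma exact_sub_eq (hF : Measurable (Function.uncurry F))
    (hLip : ∀ x y s, ‖F x s - F y s‖ ≤ L * ‖x - y‖) (hL : 0 ≤ L) (hM : MemLp (F ξ) 2 ν)
    (hX : Continuous X)
    (hsol : ∀ t ∈ Icc (0 : ℝ) T, X t = ξ + ∫ r in (0 : ℝ)..t, (∫ s, F (X r) s ∂ν))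
    {t : ℝ} (ht : t ∈ Icc 0 T) :
    X t - ξ = t • ∫ z, F (X (z.1 * t)) z.2 ∂((volume : Measure unitInterval).prod ν) := by
  rw [integral_prod _ ((memLp_exact hF hLip hL hM hX ht.1).integrable (by norm_num)),
    smul_integral_unitInterval_eq (fun r => ∫ s, F (X r) s ∂ν) t, hsol t ht]
  simp

/-- The error made in the integrand `F (X (r t)) s` when the exact solution `X` is replaced by the
level `l` approximation. -/
noncomputable def mlpGap (F : EuclideanSpace ℝ (Fin d) → S → EuclideanSpace ℝ (Fin d))
    (ξ : EuclideanSpace ℝ (Fin d)) (m : ℕ) (X : ℝ → EuclideanSpace ℝ (Fin d)) (t : ℝ) (l : ℕ)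
    (p : (unitInterval × S) × (MLPIndex → unitInterval × S)) : EuclideanSpace ℝ (Fin d) :=
  mlpTerm F ξ m t l p.1 p.2 - F (X (p.1.1 * t)) p.1.2

/-- The Lipschitz condition and Fubini turn an error bound that holds at all times into a bound for
the integrand. -/
lemma memLp_mlpGap (hF : Measurable (Function.uncurry F))
    (hLip : ∀ x y s, ‖F x s - F y s‖ ≤ L * ‖x - y‖)
    (hX : Continuous X) {l : ℕ} {B c : ℝ} (hB : 0 ≤ B) (hc : 0 < c)
    (h : ∀ t ∈ Icc 0 T, MemLp (fun w => mlpField F ξ m l t w - X t) 2 (noiseMeasure ν) ∧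
      ∫ w, ‖mlpField F ξ m l t w - X t‖ ^ 2 ∂noiseMeasure ν ≤ B * Real.exp (c * t))
    {t : ℝ} (ht : t ∈ Icc 0 T) :
    MemLp (mlpGap F ξ m X t l) 2 (stepMeasure ν) ∧
    t ^ 2 * ∫ p, ‖mlpGap F ξ m X t l p‖ ^ 2
        ∂(stepMeasure ν) ≤
      T * L ^ 2 * B * (Real.exp (c * t) / c) := by
  set a : ℝ := ∫ r : unitInterval, Real.exp (c * (r * t)) with ha
  have ha0 : 0 ≤ a := integral_nonneg fun _ => (Real.exp_pos _).le
  have hmf : Measurable fun p : (unitInterval × S) × (MLPIndex → unitInterval × S) =>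
      mlpField F ξ m l (p.1.1 * t) p.2 :=
    (measurable_mlpField ξ m hF l).comp (Measurable.prodMk
      ((measurable_subtype_coe.comp (measurable_fst.comp measurable_fst)).mul_const t)
      measurable_snd)
  have hmX : Measurable fun p : (unitInterval × S) × (MLPIndex → unitInterval × S) =>
      X (p.1.1 * t) := hX.measurable.comp
      ((measurable_subtype_coe.comp (measurable_fst.comp measurable_fst)).mul_const t)
  have hsq : Measurable fun p : (unitInterval × S) × (MLPIndex → unitInterval × S) =>
      ‖mlpField F ξ m l (p.1.1 * t) p.2 - X (p.1.1 * t)‖ₑ ^ 2 := ((hmf.sub hmX).enorm).pow_const 2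
  have hmg : Measurable (mlpGap F ξ m X t l) :=
    (measurable_mlpTerm ξ m hF t l).sub ((measurable_exact hF hX t).comp measurable_fst)
  have hpt : ∀ p, ‖mlpGap F ξ m X t l p‖ₑ ^ 2 ≤ ENNReal.ofReal (L ^ 2) *
      ‖mlpField F ξ m l (p.1.1 * t) p.2 - X (p.1.1 * t)‖ₑ ^ 2 := by
    intro p
    rw [← ofReal_norm, ← ofReal_norm, ← ENNReal.ofReal_pow (norm_nonneg _),
      ← ENNReal.ofReal_pow (norm_nonneg _), ← ENNReal.ofReal_mul (sq_nonneg _), ← mul_pow]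
    exact ENNReal.ofReal_le_ofReal (pow_le_pow_left₀ (norm_nonneg _) (hLip _ _ _) 2)
  have hexp : Integrable (fun r : unitInterval => Real.exp (c * (r * t))) volume :=
    (by fun_prop : Continuous fun r : unitInterval => Real.exp (c * (r * t))).integrable_of_hasCompactSupport
      (HasCompactSupport.of_compactSpace _)
  have hint : ∫⁻ p, ‖mlpGap F ξ m X t l p‖ₑ ^ 2
      ∂(stepMeasure ν) ≤
      ENNReal.ofReal (L ^ 2 * (B * a)) := by
    refine (lintegral_mono hpt).trans ?_
    rw [lintegral_const_mul _ hsq, ENNReal.ofReal_mul (sq_nonneg L)]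
    gcongr
    rw [lintegral_prod _ hsq.aemeasurable]
    calc _ ≤ ∫⁻ z : unitInterval × S, ENNReal.ofReal (B * Real.exp (c * (z.1 * t)))
          ∂((volume : Measure unitInterval).prod ν) := by
          refine lintegral_mono fun z => ?_
          have hz := unitInterval_mul_mem ht.1 z.1
          obtain ⟨h1, h2⟩ := h (z.1 * t) ⟨hz.1, hz.2.trans ht.2⟩
          rw [lintegral_enorm_sq_eq h1]
          exact ENNReal.ofReal_le_ofReal h2
      _ = ∫⁻ r : unitInterval, ENNReal.ofReal (B * Real.exp (c * (r * t))) := by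
          rw [lintegral_prod _ (by fun_prop)]
          simp
      _ = ENNReal.ofReal (B * a) := by
          rw [← ofReal_integral_eq_lintegral_ofReal (hexp.const_mul B)
            (.of_forall fun _ => mul_nonneg hB (Real.exp_pos _).le), integral_const_mul]
  obtain ⟨h1, h2⟩ := memLp_two_of_lintegral_le hmg.aestronglyMeasurable (by positivity) hint
  refine ⟨h1, ?_⟩
  have hta : t * a ≤ Real.exp (c * t) / c := mul_integral_exp_le hc
  have ht0 := ht.1
  calc t ^ 2 * _ ≤ t ^ 2 * (L ^ 2 * (B * a)) := by gcongr
    _ = t * L ^ 2 * B * (t * a) := by ring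
    _ ≤ T * L ^ 2 * B * (Real.exp (c * t) / c) := by
        have := mul_nonneg ht0 ha0
        gcongr
        · have := ht0.trans ht.2; positivity
        · exact ht.2

lemma memLp_mlpTerm
    (hE : ∀ t, 0 ≤ t → MemLp (fun z : unitInterval × S => F (X (z.1 * t)) z.2) 2
      ((volume : Measure unitInterval).prod ν)) {t : ℝ} (ht : 0 ≤ t) {l : ℕ}
    (hgap : MemLp (mlpGap F ξ m X t l) 2
      (stepMeasure ν)) :
    MemLp (fun p : (unitInterval × S) × (MLPIndex → unitInterval × S) =>
      mlpTerm F ξ m t l p.1 p.2) 2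
      (stepMeasure ν) := by
  refine (hgap.add ((hE t ht).comp_fst (noiseMeasure ν))).ae_eq (.of_forall fun p => ?_)
  simp [mlpGap]

lemma memLp_mlpDiff {t : ℝ} {l : ℕ} (k : ℕ)
    (h1 : ∀ j ≤ l, MemLp (fun p : (unitInterval × S) × (MLPIndex → unitInterval × S) =>
      mlpTerm F ξ m t j p.1 p.2) 2
      (stepMeasure ν)) :
    MemLp (mlpDiff F ξ m t l k) 2 (noiseMeasure ν) := by
  have a1 := (h1 l le_rfl).comp_measurePreserving (measurePreserving_node_shift l k k)
  unfold mlpDiff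
  split_ifs
  · simp only [sub_zero]
    exact a1
  · exact a1.sub ((h1 (l - 1) (Nat.sub_le _ _)).comp_measurePreserving
      (measurePreserving_node_shift l k (-k)))

/-- The mean of a level correction is a difference of means at consecutive levels, because the
approximations at `(l, k)` and at `(l, -k)` see noise with the same law. -/
lemma integral_mlpDiff {t : ℝ} {l : ℕ} (k : ℕ)
    (h1 : ∀ j ≤ l, MemLp (fun p : (unitInterval × S) × (MLPIndex → unitInterval × S) =>
      mlpTerm F ξ m t j p.1 p.2) 2
      (stepMeasure ν)) :
    ∫ w, mlpDiff F ξ m t l k w ∂noiseMeasure ν =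
      ∫ p, mlpTerm F ξ m t l p.1 p.2
          ∂(stepMeasure ν) -
        if l = 0 then 0 else ∫ p, mlpTerm F ξ m t (l - 1) p.1 p.2
          ∂(stepMeasure ν) := by
  have key : ∀ j ≤ l, ∀ k' : ℤ,
      Integrable (fun w => mlpTerm F ξ m t j (w (.node l k)) ((MLPIndex.node l k').shift w))
        (noiseMeasure ν) ∧
      ∫ w, mlpTerm F ξ m t j (w (.node l k)) ((MLPIndex.node l k').shift w) ∂noiseMeasure ν =
      ∫ p, mlpTerm F ξ m t j p.1 p.2
          ∂(stepMeasure ν) := by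
    intro j hj k'
    have hp := measurePreserving_node_shift (ν := ν) l k k'
    refine ⟨((h1 j hj).comp_measurePreserving hp).integrable (by norm_num), ?_⟩
    rw [← hp.map_eq, integral_map hp.measurable.aemeasurable]
    rw [hp.map_eq]
    exact (h1 j hj).aestronglyMeasurable
  unfold mlpDiff
  split_ifs
  · simpa using (key l le_rfl k).2
  · rw [integral_sub (key l le_rfl k).1 (key (l - 1) (Nat.sub_le _ _) _).1, (key l le_rfl k).2,
      (key (l - 1) (Nat.sub_le _ _) _).2]

lemma integral_norm_mlpDiff_zero_sq_eq (hM : MemLp (F ξ) 2 ν) (t : ℝ) (k : ℕ) :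
    ∫ w, ‖mlpDiff F ξ m t 0 k w‖ ^ 2 ∂noiseMeasure ν = ∫ s, ‖F ξ s‖ ^ 2 ∂ν := by
  have hp : MeasurePreserving (fun w : MLPIndex → unitInterval × S => (w (.node 0 k)).2)
      (noiseMeasure ν) ν :=
    measurePreserving_snd.comp (measurePreserving_fst.comp (measurePreserving_node_shift 0 k k))
  have h : ∀ w, ‖mlpDiff F ξ m t 0 k w‖ ^ 2 = ‖F ξ (w (.node 0 k)).2‖ ^ 2 := by
    intro w
    simp [mlpDiff, mlpTerm]
  simp_rw [h]
  conv_rhs => rw [← hp.map_eq]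
  rw [integral_map hp.measurable.aemeasurable (f := fun s => ‖F ξ s‖ ^ 2)]
  rw [hp.map_eq]
  exact hM.aestronglyMeasurable.norm.pow 2

/-- Both halves of a level correction are compared with the exact solution at the same random time;
the exact integrand cancels. -/
lemma integral_norm_mlpDiff_succ_sq_le {t : ℝ} {l : ℕ} (k : ℕ)
    (hgap : ∀ j ≤ l + 1, MemLp (mlpGap F ξ m X t j) 2
      (stepMeasure ν)) :
    ∫ w, ‖mlpDiff F ξ m t (l + 1) k w‖ ^ 2 ∂noiseMeasure ν ≤
      2 * (∫ p, ‖mlpGap F ξ m X t (l + 1) p‖ ^ 2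
          ∂(stepMeasure ν) +
        ∫ p, ‖mlpGap F ξ m X t l p‖ ^ 2
          ∂(stepMeasure ν)) := by
  have hp := fun k' : ℤ => measurePreserving_node_shift (ν := ν) (l + 1 : ℕ) k k'
  have hmem : ∀ j ≤ l + 1, ∀ k' : ℤ, MemLp (fun w => mlpGap F ξ m X t j
      (w (.node (l + 1 : ℕ) k), (MLPIndex.node (l + 1 : ℕ) k').shift w)) 2 (noiseMeasure ν) :=
    fun j hj k' => (hgap j hj).comp_measurePreserving (hp k')
  have hint : ∀ j ≤ l + 1, ∀ k' : ℤ, ∫ w, ‖mlpGap F ξ m X t j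
      (w (.node (l + 1 : ℕ) k), (MLPIndex.node (l + 1 : ℕ) k').shift w)‖ ^ 2 ∂noiseMeasure ν =
      ∫ p, ‖mlpGap F ξ m X t j p‖ ^ 2
          ∂(stepMeasure ν) := by
    intro j hj k'
    conv_rhs => rw [← (hp k').map_eq]
    rw [integral_map (hp k').measurable.aemeasurable (f := fun p => ‖mlpGap F ξ m X t j p‖ ^ 2)]
    rw [(hp k').map_eq]
    exact (hgap j hj).aestronglyMeasurable.norm.pow 2
  rw [← hint (l + 1) le_rfl k, ← hint l (Nat.le_succ l) (-k),
    ← integral_add (hmem _ le_rfl _).norm.integrable_sq (hmem _ (Nat.le_succ l) _).norm.integrable_sq,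
    ← integral_const_mul]
  refine integral_mono_of_nonneg (.of_forall fun _ => sq_nonneg _)
    (((hmem _ le_rfl _).norm.integrable_sq.add
      (hmem _ (Nat.le_succ l) _).norm.integrable_sq).const_mul 2) (.of_forall fun w => ?_)
  have heq : mlpDiff F ξ m t (l + 1) k w =
      mlpGap F ξ m X t (l + 1)
        (w (.node (l + 1 : ℕ) k), (MLPIndex.node (l + 1 : ℕ) k).shift w) -
      mlpGap F ξ m X t l
        (w (.node (l + 1 : ℕ) k), (MLPIndex.node (l + 1 : ℕ) (-(k : ℤ))).shift w) := by
    simp [mlpDiff, mlpGap]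
  simp only [heq]
  have h := norm_sub_le (mlpGap F ξ m X t (l + 1)
        (w (.node (l + 1 : ℕ) k), (MLPIndex.node (l + 1 : ℕ) k).shift w))
      (mlpGap F ξ m X t l
        (w (.node (l + 1 : ℕ) k), (MLPIndex.node (l + 1 : ℕ) (-(k : ℤ))).shift w))
  exact (pow_le_pow_left₀ (norm_nonneg _) h 2).trans (add_sq_le)

/-- The squared bias. -/
lemma norm_exact_sub_mean_sq_le (hF : Measurable (Function.uncurry F))
    (hLip : ∀ x y s, ‖F x s - F y s‖ ≤ L * ‖x - y‖) (hL : 0 ≤ L) (hM : MemLp (F ξ) 2 ν)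
    (hX : Continuous X)
    (hsol : ∀ t ∈ Icc (0 : ℝ) T, X t = ξ + ∫ r in (0 : ℝ)..t, (∫ s, F (X r) s ∂ν))
    {t : ℝ} (ht : t ∈ Icc 0 T) {n : ℕ} (hgap : MemLp (mlpGap F ξ m X t n) 2 (stepMeasure ν)) :
    ‖X t - ξ - t • ∫ p, mlpTerm F ξ m t n p.1 p.2 ∂stepMeasure ν‖ ^ 2 ≤
      t ^ 2 * ∫ p, ‖mlpGap F ξ m X t n p‖ ^ 2 ∂stepMeasure ν := by
  have hE := fun (t : ℝ) (ht : 0 ≤ t) => memLp_exact hF hLip hL hM hX ht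
  have h2 : ∫ p, mlpGap F ξ m X t n p ∂stepMeasure ν =
      ∫ p, mlpTerm F ξ m t n p.1 p.2 ∂stepMeasure ν -
        ∫ z, F (X (z.1 * t)) z.2 ∂((volume : Measure unitInterval).prod ν) := by
    simp only [mlpGap]
    rw [integral_sub ((memLp_mlpTerm hE ht.1 hgap).integrable (by norm_num))
      (((hE t ht.1).comp_fst (noiseMeasure ν)).integrable (by norm_num)), stepMeasure,
      integral_fun_fst (fun z : unitInterval × S => F (X (z.1 * t)) z.2)]
    simp
  have h1 : X t - ξ - t • ∫ p, mlpTerm F ξ m t n p.1 p.2 ∂stepMeasure ν =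
      -(t • ∫ p, mlpGap F ξ m X t n p ∂stepMeasure ν) := by
    rw [exact_sub_eq hF hLip hL hM hX hsol ht, h2, smul_sub]
    abel
  rw [h1, norm_neg, norm_smul, mul_pow, Real.norm_eq_abs, sq_abs]
  gcongr
  exact norm_integral_sq_le hgap

/-- The sum of the second moments of the summands of the recursion, which bounds the variance. -/
lemma sum_integral_norm_smul_mlpDiff_sq_le (hm : 1 ≤ m) (hM : MemLp (F ξ) 2 ν) {t : ℝ} (n : ℕ)
    (hgap : ∀ j ≤ n, MemLp (mlpGap F ξ m X t j) 2 (stepMeasure ν))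
    (a : ℕ → ℝ) (ha : ∀ j ≤ n, t ^ 2 * ∫ p, ‖mlpGap F ξ m X t j p‖ ^ 2 ∂stepMeasure ν ≤ a j) :
    ∑ l ∈ Finset.range (n + 1), ∑ k ∈ Finset.Icc 1 (m ^ (n + 1 - l)),
      ∫ w, ‖(t / (m : ℝ) ^ (n + 1 - l)) • mlpDiff F ξ m t l k w‖ ^ 2 ∂noiseMeasure ν ≤
      (t ^ 2 * ∫ s, ‖F ξ s‖ ^ 2 ∂ν) / m ^ (n + 1) +
        ∑ l ∈ Finset.range n, 2 * (a (l + 1) + a l) / m ^ (n - l) := by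
  have hm0 : (0 : ℝ) < m := by exact_mod_cast hm
  have hY : ∀ l k, ∫ w, ‖(t / (m : ℝ) ^ (n + 1 - l)) • mlpDiff F ξ m t l k w‖ ^ 2
      ∂noiseMeasure ν =
      (t / (m : ℝ) ^ (n + 1 - l)) ^ 2 * ∫ w, ‖mlpDiff F ξ m t l k w‖ ^ 2 ∂noiseMeasure ν := by
    intro l k
    simp only [norm_smul, mul_pow, Real.norm_eq_abs, sq_abs]
    rw [integral_const_mul]
  have hc2 : ∀ (l : ℕ) (q : ℝ), ∑ _k ∈ Finset.Icc 1 (m ^ (n + 1 - l)),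
      (t / (m : ℝ) ^ (n + 1 - l)) ^ 2 * q = t ^ 2 * q / m ^ (n + 1 - l) := by
    intro l q
    rw [Finset.sum_const, Nat.card_Icc, nsmul_eq_mul]
    push_cast [Nat.add_sub_cancel]
    field_simp
  simp only [hY]
  rw [Finset.sum_range_succ', add_comm]
  refine add_le_add (le_of_eq ?_) (Finset.sum_le_sum fun l hl => ?_)
  · rw [Finset.sum_congr rfl fun k _ => by rw [integral_norm_mlpDiff_zero_sq_eq hM t k], hc2]
    simp
  · have hl' : l + 1 ≤ n := Finset.mem_range.1 hl
    calc _ ≤ ∑ _k ∈ Finset.Icc 1 (m ^ (n + 1 - (l + 1))), (t / (m : ℝ) ^ (n + 1 - (l + 1))) ^ 2 *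
          (2 * (∫ p, ‖mlpGap F ξ m X t (l + 1) p‖ ^ 2 ∂stepMeasure ν +
            ∫ p, ‖mlpGap F ξ m X t l p‖ ^ 2 ∂stepMeasure ν)) := by
          refine Finset.sum_le_sum fun k _ => ?_
          refine mul_le_mul_of_nonneg_left ?_ (sq_nonneg _)
          exact integral_norm_mlpDiff_succ_sq_le k fun j hj => hgap j (hj.trans hl')
      _ = 2 * (t ^ 2 * ∫ p, ‖mlpGap F ξ m X t (l + 1) p‖ ^ 2 ∂stepMeasure ν +
            t ^ 2 * ∫ p, ‖mlpGap F ξ m X t l p‖ ^ 2 ∂stepMeasure ν) / m ^ (n - l) := by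
          rw [hc2, Nat.add_sub_add_right]; ring
      _ ≤ _ := by
          have h1 := ha _ hl'
          have h2 := ha l (by omega)
          refine div_le_div_of_nonneg_right ?_ (by positivity)
          linarith

/-- One step of the error recursion: the squared error at level `n + 1` is at most the squared bias
plus the sum of the variances, both expressed through the errors of the integrand at levels `≤ n`. -/
lemma integral_norm_mlpField_sub_sq_le (hm : 1 ≤ m) (hF : Measurable (Function.uncurry F))
    (hLip : ∀ x y s, ‖F x s - F y s‖ ≤ L * ‖x - y‖) (hL : 0 ≤ L) (hM : MemLp (F ξ) 2 ν)
    (hX : Continuous X)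
    (hsol : ∀ t ∈ Icc (0 : ℝ) T, X t = ξ + ∫ r in (0 : ℝ)..t, (∫ s, F (X r) s ∂ν))
    {t : ℝ} (ht : t ∈ Icc 0 T) (n : ℕ)
    (hgap : ∀ j ≤ n, MemLp (mlpGap F ξ m X t j) 2
      (stepMeasure ν))
    (a : ℕ → ℝ) (ha : ∀ j ≤ n, t ^ 2 * ∫ p, ‖mlpGap F ξ m X t j p‖ ^ 2
      ∂(stepMeasure ν) ≤ a j) :
    MemLp (fun w => mlpField F ξ m (n + 1) t w - X t) 2 (noiseMeasure ν) ∧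
    ∫ w, ‖mlpField F ξ m (n + 1) t w - X t‖ ^ 2 ∂noiseMeasure ν ≤
      a n + (t ^ 2 * ∫ s, ‖F ξ s‖ ^ 2 ∂ν) / m ^ (n + 1) +
        ∑ l ∈ Finset.range n, 2 * (a (l + 1) + a l) / m ^ (n - l) := by
  have hm0 : (0 : ℝ) < m := by exact_mod_cast hm
  have hE := fun (t : ℝ) (ht : 0 ≤ t) => memLp_exact hF hLip hL hM hX ht
  have hterm : ∀ j ≤ n, MemLp (fun p : (unitInterval × S) × (MLPIndex → unitInterval × S) =>
      mlpTerm F ξ m t j p.1 p.2) 2 (stepMeasure ν) := fun j hj => memLp_mlpTerm hE ht.1 (hgap j hj)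
  let s : Finset ((_ : ℕ) × ℕ) :=
    (Finset.range (n + 1)).sigma fun l => Finset.Icc 1 (m ^ (n + 1 - l))
  let Y : ((_ : ℕ) × ℕ) → (MLPIndex → unitInterval × S) → EuclideanSpace ℝ (Fin d) :=
    fun i w => (t / (m : ℝ) ^ (n + 1 - i.1)) • mlpDiff F ξ m t i.1 i.2 w
  have hs : ∀ i ∈ s, i.1 ≤ n ∧ 1 ≤ i.2 := fun i hi => by
    simp only [s, Finset.mem_sigma, Finset.mem_range, Finset.mem_Icc] at hi
    omega
  have hYmem : ∀ i ∈ s, MemLp (Y i) 2 (noiseMeasure ν) := fun i hi =>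
    (memLp_mlpDiff i.2 fun j hj => hterm j (hj.trans (hs i hi).1)).const_smul
      (t / (m : ℝ) ^ (n + 1 - i.1))
  have hind : (s : Set ((_ : ℕ) × ℕ)).Pairwise fun i j => IndepFun (Y i) (Y j) (noiseMeasure ν) := by
    intro i hi j hj hij
    refine (indepFun_mlpDiff hF t (hs i hi).2 (hs j hj).2 fun h => hij ?_).comp
      (measurable_const_smul _) (measurable_const_smul _)
    simp only [Prod.mk.injEq] at h
    exact Sigma.ext h.1 (heq_of_eq h.2)
  have hfield : ∀ w, mlpField F ξ m (n + 1) t w = ξ + ∑ i ∈ s, Y i w := by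
    intro w
    rw [mlpField_eq, Finset.sum_sigma]
  have hcard : ∀ l, (m ^ (n + 1 - l) : ℝ) * (t / (m : ℝ) ^ (n + 1 - l)) = t := fun l => by
    field_simp
  set η : ℕ → EuclideanSpace ℝ (Fin d) := fun l => ∫ p, mlpTerm F ξ m t l p.1 p.2 ∂stepMeasure ν with hη
  -- the means of the level corrections telescope
  have htel : ∀ N, ∑ l ∈ Finset.range (N + 1), (η l - if l = 0 then 0 else η (l - 1)) = η N := by
    intro N
    induction N with
    | zero => simp
    | succ N ih => rw [Finset.sum_range_succ, ih]; simp
  have hmean : ∑ i ∈ s, ∫ w, Y i w ∂noiseMeasure ν = t • η n := by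
    rw [Finset.sum_sigma, ← htel n, Finset.smul_sum]
    refine Finset.sum_congr rfl fun l hl => ?_
    have hl' : l ≤ n := Nat.lt_succ_iff.1 (Finset.mem_range.1 hl)
    have : ∀ k ∈ Finset.Icc 1 (m ^ (n + 1 - l)), ∫ w, Y ⟨l, k⟩ w ∂noiseMeasure ν =
        (t / (m : ℝ) ^ (n + 1 - l)) • (η l - if l = 0 then 0 else η (l - 1)) := fun k _ => by
      simp only [Y]
      rw [integral_smul, integral_mlpDiff k fun j hj => hterm j (hj.trans hl')]
    rw [Finset.sum_congr rfl this, Finset.sum_const, Nat.card_Icc, ← Nat.cast_smul_eq_nsmul ℝ,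
      smul_smul]
    congr 1
    simpa using hcard l
  have hbias : ‖X t - ξ - t • η n‖ ^ 2 ≤ a n :=
    (norm_exact_sub_mean_sq_le hF hLip hL hM hX hsol ht (hgap n le_rfl)).trans (ha n le_rfl)
  have hvar : ∑ i ∈ s, ∫ w, ‖Y i w‖ ^ 2 ∂noiseMeasure ν ≤
      (t ^ 2 * ∫ s, ‖F ξ s‖ ^ 2 ∂ν) / m ^ (n + 1) +
        ∑ l ∈ Finset.range n, 2 * (a (l + 1) + a l) / m ^ (n - l) := by
    rw [Finset.sum_sigma]
    exact sum_integral_norm_smul_mlpDiff_sq_le hm hM n hgap a ha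
  refine ⟨?_, ?_⟩
  · have hsum : MemLp (fun w => ∑ i ∈ s, Y i w) 2 (noiseMeasure ν) := memLp_finsetSum s hYmem
    have hconst : MemLp (fun _ : MLPIndex → unitInterval × S => ξ - X t) 2 (noiseMeasure ν) :=
      memLp_const _
    have heq : (fun w => mlpField F ξ m (n + 1) t w - X t) =
        fun w => (ξ - X t) + ∑ i ∈ s, Y i w := by
      funext w
      rw [hfield]
      abel
    rw [heq]
    exact hconst.add hsum
  · have h := integral_norm_sub_sum_sq_le s hYmem hind (X t - ξ)
    rw [hmean] at h
    have heq : ∀ w, ‖mlpField F ξ m (n + 1) t w - X t‖ = ‖X t - ξ - ∑ i ∈ s, Y i w‖ := by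
      intro w
      rw [hfield, ← norm_neg]
      congr 1
      abel
    simp_rw [heq]
    linarith

/-- The mean squared error at level `n` is at most `A (6 / m) ^ n exp (κ m t)`. The weight
`exp (κ m t)` compensates the factor `m` by which the bias of level `n` exceeds `m ^ (-n)`. -/
theorem exists_mlpField_error_bound (hF : Measurable (Function.uncurry F))
    (hLip : ∀ x y s, ‖F x s - F y s‖ ≤ L * ‖x - y‖) (hL : 0 ≤ L) (hM : MemLp (F ξ) 2 ν)
    (hX : Continuous X) (hT : 0 ≤ T)
    (hsol : ∀ t ∈ Icc (0 : ℝ) T, X t = ξ + ∫ r in (0 : ℝ)..t, (∫ s, F (X r) s ∂ν)) :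
    ∃ A κ : ℝ, 0 ≤ A ∧ 0 < κ ∧ ∀ m : ℕ, 1 ≤ m → ∀ n : ℕ, ∀ t ∈ Icc (0 : ℝ) T,
      MemLp (fun w => mlpField F ξ m n t w - X t) 2 (noiseMeasure ν) ∧
      ∫ w, ‖mlpField F ξ m n t w - X t‖ ^ 2 ∂noiseMeasure ν ≤
        A * 6 ^ n / m ^ n * Real.exp (κ * m * t) := by
  obtain ⟨K, hK0, hK⟩ := exists_norm_sub_le hX ξ 0 T
  set M := ∫ s, ‖F ξ s‖ ^ 2 ∂ν with hMdef
  have hM0 : 0 ≤ M := integral_nonneg fun _ => sq_nonneg _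
  refine ⟨T ^ 2 * M + K ^ 2, T * L ^ 2 + 1, by positivity, by positivity, fun m hm n => ?_⟩
  have hm0 : (0 : ℝ) < m := by exact_mod_cast hm
  have hm1 : (1 : ℝ) ≤ m := by exact_mod_cast hm
  set A := T ^ 2 * M + K ^ 2 with hA
  have hA0 : 0 ≤ A := by positivity
  set κ := T * L ^ 2 + 1 with hκ
  have hκ0 : 0 < κ := by positivity
  induction n using Nat.strong_induction_on with
  | _ n ih =>
    intro t ht
    have hexp : 1 ≤ Real.exp (κ * m * t) :=
      Real.one_le_exp (by have := ht.1; positivity)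
    cases n with
    | zero =>
      simp only [mlpField_zero]
      refine ⟨memLp_const _, ?_⟩
      have h1 : ‖ξ - X t‖ ^ 2 ≤ K ^ 2 := by
        rw [norm_sub_rev]
        exact pow_le_pow_left₀ (norm_nonneg _) (hK t ht) 2
      have h2 : K ^ 2 ≤ A := by rw [hA]; nlinarith [mul_nonneg (sq_nonneg T) hM0]
      simp only [integral_const, probReal_univ, one_smul, pow_zero, mul_one, div_one]
      nlinarith
    | succ n =>
      set e := Real.exp (κ * m * t) with he
      have hg : ∀ j ≤ n, _ := fun j (hj : j ≤ n) => memLp_mlpGap hF hLip hX (l := j)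
        (B := A * 6 ^ j / m ^ j) (c := κ * m) (by positivity) (by positivity)
        (ih j (Nat.lt_succ_of_le hj)) ht
      obtain ⟨h1, h2⟩ := integral_norm_mlpField_sub_sq_le hm hF hLip hL hM hX hsol ht n
        (fun j hj => (hg j hj).1) (fun j => A * 6 ^ j / m ^ (j + 1) * e) fun j hj => by
          refine (hg j hj).2.trans ?_
          have h3 : T * L ^ 2 / κ ≤ 1 := by rw [div_le_one hκ0]; linarith
          calc T * L ^ 2 * (A * 6 ^ j / m ^ j) * (e / (κ * m))
              = T * L ^ 2 / κ * (A * 6 ^ j / m ^ (j + 1) * e) := by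
                field_simp; ring
            _ ≤ _ := mul_le_of_le_one_left (by positivity) h3
      refine ⟨h1, h2.trans ?_⟩
      -- the bound at level `n + 1` needs `6 ^ n + 1 + 14 (6 ^ n - 1) / 5 ≤ 6 ^ (n + 1)`
      have hgeom : ∀ N : ℕ, ∑ l ∈ Finset.range N, (14 : ℝ) * 6 ^ l = 14 * (6 ^ N - 1) / 5 := by
        intro N
        rw [← Finset.mul_sum, geom_sum_eq (by norm_num)]
        ring
      have hfirst : t ^ 2 * M / m ^ (n + 1) ≤ A / m ^ (n + 1) * e := by
        have h4 : t ^ 2 * M ≤ A := by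
          have : t ^ 2 * M ≤ T ^ 2 * M := by
            have := ht.1; have := ht.2; gcongr
          nlinarith
        calc t ^ 2 * M / m ^ (n + 1) ≤ A / m ^ (n + 1) := by gcongr
          _ ≤ _ := le_mul_of_one_le_right (by positivity) hexp
      have hsum : ∑ l ∈ Finset.range n, 2 * (A * 6 ^ (l + 1) / m ^ (l + 1 + 1) * e +
          A * 6 ^ l / m ^ (l + 1) * e) / m ^ (n - l) ≤
          ∑ l ∈ Finset.range n, A / m ^ (n + 1) * e * (14 * 6 ^ l) := by
        refine Finset.sum_le_sum fun l hl => ?_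
        have hl' : l < n := Finset.mem_range.1 hl
        have h5 : (m : ℝ) ^ (n + 1) = m ^ (l + 1) * m ^ (n - l) := by
          rw [← pow_add]; congr 1; omega
        have h6 : A * 6 ^ (l + 1) / m ^ (l + 1 + 1) * e ≤ A * 6 ^ (l + 1) / m ^ (l + 1) * e := by
          gcongr ?_ * _
          exact div_le_div_of_nonneg_left (by positivity) (by positivity)
            (pow_le_pow_right₀ hm1 (Nat.le_succ _))
        calc _ ≤ 2 * (A * 6 ^ (l + 1) / m ^ (l + 1) * e + A * 6 ^ l / m ^ (l + 1) * e) /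
              m ^ (n - l) := by gcongr
          _ = _ := by rw [h5, pow_succ 6 l]; field_simp; ring
      rw [← Finset.mul_sum, hgeom] at hsum
      have hpos : 0 ≤ A / m ^ (n + 1) * e := by positivity
      have h6n : (1 : ℝ) ≤ 6 ^ n := one_le_pow₀ (by norm_num)
      have hgoal : A * 6 ^ (n + 1) / m ^ (n + 1) * e = A / m ^ (n + 1) * e * 6 ^ (n + 1) := by ring
      have hfirst' : A * 6 ^ n / m ^ (n + 1) * e = A / m ^ (n + 1) * e * 6 ^ n := by ring
      rw [hgoal, hfirst', pow_succ 6 n]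
      nlinarith

end Recursion

/-! ### The cost -/

/-- The cost recursion `c n ≤ m ^ n + ∑ l, m ^ (n - l) (1 + c l + c (l - 1))` has the supersolution
`(4 m) ^ n`, since `1 + ∑ l ∈ [1, n - 1], 3 * 4 ^ l ≤ 4 ^ n`. -/
lemma card_mlpIndices_le (m : ℕ) (hm : 1 ≤ m) (n : ℕ) (θ : MLPIndex) :
    (mlpIndices m n θ).card ≤ (4 * m) ^ n := by
  induction n using Nat.strong_induction_on generalizing θ with
  | _ n ih =>
    cases n with
    | zero => simp [mlpIndices]
    | succ n =>
      rw [mlpIndices]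
      refine (Finset.card_union_le _ _).trans ?_
      have h1 : ((Finset.Icc 1 (m ^ (n + 1))).image fun k : ℕ => θ.child 0 (k : ℤ)).card ≤
          m ^ (n + 1) := Finset.card_image_le.trans (by simp)
      have h2 : ((Finset.Icc 1 n).attach.biUnion fun l =>
        (Finset.Icc 1 (m ^ (n + 1 - (l : ℕ)))).biUnion fun k : ℕ =>
          {θ.child ((l : ℕ) : ℤ) (k : ℤ)} ∪
            (mlpIndices m (l : ℕ) (θ.child ((l : ℕ) : ℤ) (k : ℤ)) ∪
              mlpIndices m ((l : ℕ) - 1) (θ.child ((l : ℕ) : ℤ) (-(k : ℤ))))).card ≤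
          ∑ l ∈ Finset.Icc 1 n, m ^ (n + 1) * (3 * 4 ^ l) := by
        rw [← Finset.sum_attach]
        refine Finset.card_biUnion_le.trans (Finset.sum_le_sum fun l _ => ?_)
        have hl := Finset.mem_Icc.1 l.2
        have hone : 1 ≤ (4 * m) ^ (l : ℕ) := Nat.one_le_pow _ _ (by omega)
        have hc : ∀ k : ℕ, (({θ.child ((l : ℕ) : ℤ) (k : ℤ)} : Finset MLPIndex) ∪
            (mlpIndices m (l : ℕ) (θ.child ((l : ℕ) : ℤ) (k : ℤ)) ∪
              mlpIndices m ((l : ℕ) - 1) (θ.child ((l : ℕ) : ℤ) (-(k : ℤ))))).card ≤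
            3 * (4 * m) ^ (l : ℕ) := by
          intro k
          have a1 := ih l (by omega) (θ.child ((l : ℕ) : ℤ) (k : ℤ))
          have a2 := (ih (l - 1) (by omega) (θ.child ((l : ℕ) : ℤ) (-(k : ℤ)))).trans
            (Nat.pow_le_pow_right (by omega : 0 < 4 * m) (Nat.sub_le (l : ℕ) 1))
          refine (Finset.card_union_le _ _).trans ?_
          have a3 := Finset.card_union_le (mlpIndices m (l : ℕ) (θ.child ((l : ℕ) : ℤ) (k : ℤ)))
            (mlpIndices m ((l : ℕ) - 1) (θ.child ((l : ℕ) : ℤ) (-(k : ℤ))))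
          rw [Finset.card_singleton]
          omega
        calc _ ≤ ∑ k ∈ Finset.Icc 1 (m ^ (n + 1 - (l : ℕ))), 3 * (4 * m) ^ (l : ℕ) :=
              Finset.card_biUnion_le.trans (Finset.sum_le_sum fun k _ => hc k)
          _ = m ^ (n + 1 - (l : ℕ)) * (3 * (4 * m) ^ (l : ℕ)) := by simp
          _ = m ^ (n + 1) * (3 * 4 ^ (l : ℕ)) := by
              have : m ^ (n + 1) = m ^ (n + 1 - (l : ℕ)) * m ^ (l : ℕ) := by
                rw [← pow_add]; congr 1; omega
              rw [this, mul_pow]; ring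
      have h3 : ∀ n : ℕ, 1 + ∑ l ∈ Finset.Icc 1 n, 3 * 4 ^ l ≤ 4 ^ (n + 1) := by
        intro n
        induction n with
        | zero => simp
        | succ n ihn =>
          rw [Finset.sum_Icc_succ_top (by omega), pow_succ 4 (n + 1)]
          omega
      calc _ ≤ m ^ (n + 1) + ∑ l ∈ Finset.Icc 1 n, m ^ (n + 1) * (3 * 4 ^ l) := by gcongr
        _ = m ^ (n + 1) * (1 + ∑ l ∈ Finset.Icc 1 n, 3 * 4 ^ l) := by
            rw [← Finset.mul_sum]; ring
        _ ≤ m ^ (n + 1) * 4 ^ (n + 1) := by gcongr; exact h3 n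
        _ = (4 * m) ^ (n + 1) := by rw [mul_pow]; ring

/-! ### Equivalence of norms and choice of the level -/

section
variable {d : ℕ}

lemma seminorm_le_norm (p : Seminorm ℝ (EuclideanSpace ℝ (Fin d))) :
    ∃ C : ℝ, 0 < C ∧ ∀ x, p x ≤ C * ‖x‖ := by
  refine ⟨1 + ∑ i, p (EuclideanSpace.basisFun (Fin d) ℝ i),
    by have := Finset.sum_nonneg fun i (_ : i ∈ Finset.univ) =>
        apply_nonneg p (EuclideanSpace.basisFun (Fin d) ℝ i)
       linarith, fun x => ?_⟩
  have hx : x = ∑ i, x i • EuclideanSpace.basisFun (Fin d) ℝ i := by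
    simpa using ((EuclideanSpace.basisFun (Fin d) ℝ).sum_repr x).symm
  calc p x = p (∑ i, x i • EuclideanSpace.basisFun (Fin d) ℝ i) := by rw [← hx]
    _ ≤ ∑ i, p (x i • EuclideanSpace.basisFun (Fin d) ℝ i) :=
        Finset.le_sum_of_subadditive p (map_zero p).le (map_add_le_add p) _ _
    _ ≤ ∑ i, ‖x‖ * p (EuclideanSpace.basisFun (Fin d) ℝ i) := by
        refine Finset.sum_le_sum fun i _ => ?_
        rw [map_smul_eq_mul]
        exact mul_le_mul_of_nonneg_right (PiLp.norm_apply_le x i) (apply_nonneg p _)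
    _ ≤ _ := by
        rw [← Finset.mul_sum, mul_comm]
        exact mul_le_mul_of_nonneg_right (by linarith) (norm_nonneg x)

lemma Seminorm.continuous_euclidean (p : Seminorm ℝ (EuclideanSpace ℝ (Fin d))) :
    Continuous p := by
  obtain ⟨C, hC, h⟩ := seminorm_le_norm p
  refine (LipschitzWith.of_dist_le_mul (K := ⟨C, hC.le⟩) fun x y => ?_).continuous
  rw [Real.dist_eq, dist_eq_norm]
  exact (abs_sub_map_le_sub p x y).trans (h _)

lemma norm_le_seminorm (p : Seminorm ℝ (EuclideanSpace ℝ (Fin d)))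
    (hp : ∀ x, p x = 0 → x = 0) :
    ∃ C : ℝ, 0 < C ∧ ∀ x, ‖x‖ ≤ C * p x := by
  by_cases hne : (Metric.sphere (0 : EuclideanSpace ℝ (Fin d)) 1).Nonempty
  · obtain ⟨u, hu, hmin⟩ := (isCompact_sphere (0 : EuclideanSpace ℝ (Fin d)) 1).exists_isMinOn hne
      p.continuous_euclidean.continuousOn
    have hu1 : ‖u‖ = 1 := by simpa using hu
    have hpu : 0 < p u := by
      refine lt_of_le_of_ne (apply_nonneg p u) fun h => ?_
      rw [hp u h.symm] at hu1
      simp at hu1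
    refine ⟨(p u)⁻¹, by positivity, fun x => ?_⟩
    by_cases hx : x = 0
    · simp [hx]
    have hx' : 0 < ‖x‖ := norm_pos_iff.2 hx
    have h1 : p u ≤ p (‖x‖⁻¹ • x) := hmin (by simp [norm_smul, hx'.ne'])
    rw [map_smul_eq_mul, norm_inv, norm_norm] at h1
    rw [← div_eq_inv_mul, le_div_iff₀ hpu]
    rw [← div_eq_inv_mul, le_div_iff₀ hx'] at h1
    linarith
  · refine ⟨1, one_pos, fun x => ?_⟩
    have hx : x = 0 := by
      by_contra hx
      exact hne ⟨‖x‖⁻¹ • x, by simp [norm_smul, norm_ne_zero_iff.2 hx]⟩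
    simp [hx]

end

/-- If the squared error with `N` levels is at most `D (b / N) ^ N` and the cost is at most
`(4 N) ^ N`, the cost to reach accuracy `ε` is of order `ε ^ (-(2 + δ))`. The least sufficient `N`
is chosen; level `N - 1` then misses the accuracy, and the cost at level `N` times the power
`1 + δ / 2` of the error bound at level `N - 1` is bounded. -/
lemma exists_levels (δ D b : ℝ) (hδ : 0 < δ) (hD : 0 < D) (hb : 0 < b) :
    ∃ (c : ℝ) (N : ℝ → ℕ), ∀ ε ∈ Set.Ioc (0 : ℝ) 1, 1 ≤ N ε ∧
      ((4 * N ε : ℕ) : ℝ) ^ N ε ≤ c * ε ^ (-(2 + δ)) ∧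
      D * (b / N ε) ^ N ε ≤ ε ^ 2 := by
  set p : ℝ := 1 + δ / 2 with hp
  -- the cost at level `n + 1` times the error at level `n` to the power `p`
  let u : ℕ → ℝ := fun n => ((4 * (n + 1) : ℕ) : ℝ) ^ (n + 1) * (D * (b / n) ^ n) ^ p
  have hlim : Tendsto (fun n : ℕ => b / (n : ℝ)) atTop (𝓝 0) :=
    tendsto_const_nhds.div_atTop tendsto_natCast_atTop_atTop
  have hex : ∀ ε : ℝ, 0 < ε → ∃ n : ℕ, 1 ≤ n ∧ D * (b / n) ^ n ≤ ε ^ 2 := by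
    intro ε hε
    have hg : Tendsto (fun n : ℕ => D * (1 / 2 : ℝ) ^ n) atTop (𝓝 (D * 0)) :=
      (tendsto_pow_atTop_nhds_zero_of_lt_one (by norm_num) (by norm_num)).const_mul D
    rw [mul_zero] at hg
    obtain ⟨n, h1, h2, h3⟩ := ((hlim.eventually_le_const (by norm_num : (0:ℝ) < 1 / 2)).and
      ((hg.eventually_le_const (by positivity : (0:ℝ) < ε ^ 2)).and (eventually_ge_atTop 1))).exists
    exact ⟨n, h3, le_trans (by gcongr) h2⟩
  have hu : BddAbove (Set.range u) := by
    refine IsBoundedUnder.bddAbove_range ⟨8 * D ^ p, ?_⟩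
    rw [eventually_map]
    have hl : Tendsto (fun n : ℕ => 16 * b ^ p * (n : ℝ) ^ (-(δ / 2))) atTop (𝓝 (16 * b ^ p * 0)) :=
      ((tendsto_rpow_neg_atTop (by positivity)).comp tendsto_natCast_atTop_atTop).const_mul _
    rw [mul_zero] at hl
    filter_upwards [hl.eventually_le_const one_pos, eventually_ge_atTop 1] with n hn hn1
    have hn0 : (0 : ℝ) < n := by exact_mod_cast hn1
    have h2n : (n : ℝ) ≤ 2 ^ n := by exact_mod_cast (Nat.lt_two_pow_self (n := n)).le
    have hn1' : (1 : ℝ) ≤ n := by exact_mod_cast hn1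
    have e1 : (D * (b / n) ^ n) ^ p = D ^ p * (b ^ p * (n : ℝ) ^ (-p)) ^ n := by
      rw [Real.mul_rpow hD.le (by positivity), ← Real.rpow_natCast, ← Real.rpow_mul (by positivity),
        mul_comm (n : ℝ) p, Real.rpow_mul (by positivity), Real.rpow_natCast,
        Real.div_rpow hb.le hn0.le, Real.rpow_neg hn0.le, div_eq_mul_inv]
    have e2 : (n : ℝ) * (n : ℝ) ^ (-p) = (n : ℝ) ^ (-(δ / 2)) := by
      rw [← Real.rpow_one_add' hn0.le (by rw [hp]; intro h; linarith), hp]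
      congr 1; ring
    have hbp : 0 < b ^ p := by positivity
    calc u n = ((4 * (n + 1) : ℕ) : ℝ) ^ (n + 1) * (D ^ p * (b ^ p * (n : ℝ) ^ (-p)) ^ n) := by
          simp only [u, e1]
      _ ≤ (8 * n : ℝ) ^ (n + 1) * (D ^ p * (b ^ p * (n : ℝ) ^ (-p)) ^ n) := by
          gcongr
          push_cast
          linarith
      _ = 8 * D ^ p * (n * (8 * b ^ p * (n * (n : ℝ) ^ (-p))) ^ n) := by
          rw [pow_succ]; simp only [mul_pow]; ring
      _ ≤ 8 * D ^ p * (2 ^ n * (8 * b ^ p * (n * (n : ℝ) ^ (-p))) ^ n) := by gcongr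
      _ = 8 * D ^ p * (16 * b ^ p * (n : ℝ) ^ (-(δ / 2))) ^ n := by
          rw [← mul_pow, e2]; congr 2; ring
      _ ≤ 8 * D ^ p * 1 := by
          gcongr
          exact pow_le_one₀ (by positivity) hn
      _ = _ := mul_one _
  obtain ⟨c, hc⟩ := hu
  have hc' : ∀ n, u n ≤ c := fun n => hc ⟨n, rfl⟩
  classical
  refine ⟨max c 4, fun ε => if h : 0 < ε then Nat.find (hex ε h) else 1, fun ε hε => ?_⟩
  simp only [hε.1, dite_true]
  have hspec := Nat.find_spec (hex ε hε.1)
  have hmin := fun k => @Nat.find_min _ _ (hex ε hε.1) k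
  generalize Nat.find (hex ε hε.1) = N at hspec hmin
  refine ⟨hspec.1, ?_, hspec.2⟩
  have hε1 : ε ^ (-(2 + δ)) = ((ε ^ 2) ^ p)⁻¹ := by
    rw [Real.rpow_neg hε.1.le, ← Real.rpow_natCast, ← Real.rpow_mul hε.1.le, hp]
    congr 2; push_cast; ring
  rcases Nat.lt_or_ge 1 N with hN | hN
  · obtain ⟨n, rfl⟩ : ∃ n, N = n + 1 := ⟨N - 1, by omega⟩
    have h1 := hmin n (Nat.lt_succ_self n)
    have h2 : ε ^ 2 < D * (b / n) ^ n := by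
      by_contra! h
      exact h1 ⟨by omega, h⟩
    have h3 : 0 < ε := hε.1
    rw [hε1, ← div_eq_mul_inv, le_div_iff₀ (by positivity)]
    refine le_trans ?_ ((hc' n).trans (le_max_left _ _))
    simp only [u]
    gcongr
  · have hN1 : N = 1 := le_antisymm hN hspec.1
    subst hN1
    have h1 : 1 ≤ ε ^ (-(2 + δ)) :=
      Real.one_le_rpow_of_pos_of_le_one_of_nonpos hε.1 hε.2 (by linarith)
    have h4 : (4 : ℝ) ≤ max c 4 := le_max_right _ _
    calc ((4 * 1 : ℕ) : ℝ) ^ 1 = 4 := by norm_num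
      _ ≤ max c 4 * ε ^ (-(2 + δ)) := by nlinarith

/-! ### From the given random variables to the product space -/

section Transfer

variable {d : ℕ} {S Ω : Type*} {F : EuclideanSpace ℝ (Fin d) → S → EuclideanSpace ℝ (Fin d)}
  {ξ : EuclideanSpace ℝ (Fin d)}

lemma MLPIndex.shift_shift {A : Type*} (q p : MLPIndex) (w : MLPIndex → A) :
    p.shift (q.shift w) = (q.append p).shift w := by
  funext r
  simp [MLPIndex.shift, MLPIndex.append_append]

/-- A solution of the recursion is `mlpField` at the noise seen from its index. -/
lemma eq_mlpField_of_recursion {T : ℝ} {m : ℕ}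
    {Z : MLPIndex → Ω → S} {R : MLPIndex → Ω → unitInterval}
    {𝒳 : ℕ → MLPIndex → ℝ → Ω → EuclideanSpace ℝ (Fin d)}
    (h𝒳 : ∀ n : ℕ, ∀ θ, ∀ t ∈ Icc (0 : ℝ) T, ∀ ω,
      𝒳 n θ t ω =
        (∑ l ∈ Finset.Icc 1 (n - 1), (t / (m : ℝ) ^ (n - l)) •
          ∑ k ∈ Finset.Icc 1 (m ^ (n - l)),
            (F (𝒳 l (θ.child l k) (R (θ.child l k) ω * t) ω) (Z (θ.child l k) ω)
              - F (𝒳 (l - 1) (θ.child l (-(k : ℤ))) (R (θ.child l k) ω * t) ω)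
                  (Z (θ.child l k) ω)))
        + (t * (if 1 ≤ n then 1 else 0) / (m : ℝ) ^ n) •
            ∑ k ∈ Finset.Icc 1 (m ^ n), F ξ (Z (θ.child 0 k) ω)
        + ξ)
    (n : ℕ) (θ : MLPIndex) {t : ℝ} (ht : t ∈ Icc (0 : ℝ) T) (ω : Ω) :
    𝒳 n θ t ω = mlpField F ξ m n t (θ.shift fun p => (R p ω, Z p ω)) := by
  induction n using Nat.strong_induction_on generalizing θ t with
  | _ n ih =>
    rw [h𝒳 n θ t ht ω, mlpField_eq]
    cases n with
    | zero => simp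
    | succ n =>
      have hst : ∀ r : unitInterval, (r : ℝ) * t ∈ Icc 0 T := fun r =>
        ⟨(unitInterval_mul_mem ht.1 r).1, (unitInterval_mul_mem ht.1 r).2.trans ht.2⟩
      rw [add_comm _ ξ, Finset.sum_range_succ']
      congr 1
      have hI : ∀ f : ℕ → EuclideanSpace ℝ (Fin d),
          ∑ l ∈ Finset.Icc 1 n, f l = ∑ l ∈ Finset.range n, f (l + 1) := fun f => by
        rw [Finset.range_eq_Ico, Finset.sum_Ico_add' f 0 n 1]
        rfl
      rw [Nat.add_sub_cancel, hI]
      congr 1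
      · refine Finset.sum_congr rfl fun l hl => ?_
        have hl' : l < n := Finset.mem_range.1 hl
        rw [Finset.smul_sum]
        refine Finset.sum_congr rfl fun k _ => ?_
        rw [ih (l + 1) (by omega) _ (hst _), ih (l + 1 - 1) (by omega) _ (hst _)]
        simp [mlpDiff, mlpTerm, MLPIndex.shift_shift, MLPIndex.append_node, MLPIndex.shift]
      · rw [Finset.smul_sum]
        refine Finset.sum_congr (by simp) fun k _ => ?_
        simp [mlpDiff, mlpTerm, MLPIndex.append_node, MLPIndex.shift]

/-- The noise seen from any index has law `noiseMeasure`. -/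
lemma map_shift_noise [MeasurableSpace S] [MeasurableSpace Ω] {P : Measure Ω}
    [IsProbabilityMeasure P]
    {Z : MLPIndex → Ω → S} (hZm : ∀ θ, Measurable (Z θ)) (hZindep : iIndepFun Z P)
    {ν : Measure S} [IsProbabilityMeasure ν] (hZ : ∀ θ, P.map (Z θ) = ν)
    {R : MLPIndex → Ω → unitInterval} (hRm : ∀ θ, Measurable (R θ)) (hRindep : iIndepFun R P)
    (hR : ∀ θ, P.map (R θ) = volume)
    (hRZ : IndepFun (fun ω θ => R θ ω) (fun ω θ => Z θ ω) P) (θ : MLPIndex) :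
    MeasurePreserving (fun ω => θ.shift fun p => (R p ω, Z p ω)) P (noiseMeasure ν) := by
  have hm : ∀ p, Measurable fun ω => (R p ω, Z p ω) := fun p => (hRm p).prodMk (hZm p)
  have hW := (iIndepFun.prodMk_of_indepFun hRm hZm hRindep hZindep hRZ).precomp θ.append_injective
  have hlaw : ∀ p, P.map (fun ω => (R p ω, Z p ω)) = (volume : Measure unitInterval).prod ν := by
    intro p
    have hi : IndepFun (R p) (Z p) P :=
      hRZ.comp (φ := fun u : MLPIndex → unitInterval => u p) (ψ := fun v : MLPIndex → S => v p)
        (measurable_pi_apply p) (measurable_pi_apply p)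
    rw [(indepFun_iff_map_prod_eq_prod_map_map (hRm p).aemeasurable (hZm p).aemeasurable).1 hi,
      hR, hZ]
  refine ⟨measurable_pi_lambda _ fun p => hm _, ?_⟩
  have h := hW.map_fun_eq_infinitePi_map (fun p => hm _)
  simp only [hlaw] at h
  exact h

end Transfer

theorem theorem1p1
    (d : ℕ) (hd : 1 ≤ d) (δ : ℝ) (hδ : 0 < δ)
    (T L : ℝ) (hT : 0 ≤ T) (hL : 0 ≤ L)
    -- `X ∈ C([0,T], ℝᵈ)`
    (X : ℝ → EuclideanSpace ℝ (Fin d)) (hX : ContinuousOn X (Set.Icc 0 T))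
    (ξ : EuclideanSpace ℝ (Fin d))
    -- an arbitrary norm on `ℝᵈ`
    (nrm : Seminorm ℝ (EuclideanSpace ℝ (Fin d))) (hnrm : ∀ x, nrm x = 0 → x = 0)
    {S : Type*} [MeasurableSpace S]
    (F : EuclideanSpace ℝ (Fin d) → S → EuclideanSpace ℝ (Fin d))
    (hF : Measurable (Function.uncurry F))
    (hLip : ∀ x y s, nrm (F x s - F y s) ≤ L * nrm (x - y))
    {Ω : Type*} [MeasurableSpace Ω] (P : MeasureTheory.Measure Ω)
    [MeasureTheory.IsProbabilityMeasure P]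
    -- `Z^θ`, `θ ∈ Θ`, are i.i.d.
    (Z : MLPIndex → Ω → S) (hZm : ∀ θ, Measurable (Z θ))
    (hZindep : ProbabilityTheory.iIndepFun Z P)
    (hZident : ∀ θ ϑ, ProbabilityTheory.IdentDistrib (Z θ) (Z ϑ) P P)
    (hFint : MeasureTheory.Integrable (fun ω => nrm (F ξ (Z MLPIndex.zero ω)) ^ 2) P)
    (hsol : ∀ t ∈ Set.Icc (0 : ℝ) T,
      X t = ξ + ∫ r in (0 : ℝ)..t, (∫ ω, F (X r) (Z MLPIndex.zero ω) ∂P))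
    -- `𝔯^θ`, `θ ∈ Θ`, are independent, uniformly distributed on `[0,1]`
    (𝔯 : MLPIndex → Ω → ℝ) (h𝔯01 : ∀ θ ω, 𝔯 θ ω ∈ Set.Icc (0 : ℝ) 1)
    (h𝔯m : ∀ θ, Measurable (𝔯 θ))
    (h𝔯indep : ProbabilityTheory.iIndepFun 𝔯 P)
    (h𝔯unif : ∀ θ, P.map (𝔯 θ) = MeasureTheory.volume.restrict (Set.Icc (0 : ℝ) 1))
    -- the families `(𝔯^θ)_θ` and `(Z^θ)_θ` are independent
    (h𝔯Z : ProbabilityTheory.IndepFun (fun ω θ => 𝔯 θ ω) (fun ω θ => Z θ ω) P)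
    -- the approximations `𝒳_{n,m}^θ(t)`
    (𝒳 : ℕ → ℕ → MLPIndex → ℝ → Ω → EuclideanSpace ℝ (Fin d))
    (h𝒳 : ∀ n m : ℕ, 1 ≤ m → ∀ θ, ∀ t ∈ Set.Icc (0 : ℝ) T, ∀ ω,
      𝒳 n m θ t ω =
        (∑ l ∈ Finset.Icc 1 (n - 1), (t / (m : ℝ) ^ (n - l)) •
          ∑ k ∈ Finset.Icc 1 (m ^ (n - l)),
            (F (𝒳 l m (θ.child l k) (𝔯 (θ.child l k) ω * t) ω) (Z (θ.child l k) ω)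
              - F (𝒳 (l - 1) m (θ.child l (-(k : ℤ))) (𝔯 (θ.child l k) ω * t) ω)
                  (Z (θ.child l k) ω)))
        + (t * (if 1 ≤ n then 1 else 0) / (m : ℝ) ^ n) •
            ∑ k ∈ Finset.Icc 1 (m ^ n), F ξ (Z (θ.child 0 k) ω)
        + ξ) :
    ∃ (c : ℝ) (N : ℝ → ℕ), ∀ ε ∈ Set.Ioc (0 : ℝ) 1,
      1 ≤ N ε ∧
      (mlpRV (N ε) (N ε) : ℝ) ≤ c * ε ^ (-(2 + δ)) ∧
      MeasureTheory.Integrable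
        (fun ω => nrm (X T - 𝒳 (N ε) (N ε) MLPIndex.zero T ω) ^ 2) P ∧
      (∫ ω, nrm (X T - 𝒳 (N ε) (N ε) MLPIndex.zero T ω) ^ 2 ∂P) ^ ((1 : ℝ) / 2) ≤ ε := by
  obtain ⟨C₁, hC₁, hle₁⟩ := seminorm_le_norm nrm
  obtain ⟨C₂, hC₂, hle₂⟩ := norm_le_seminorm nrm hnrm
  have hcont := nrm.continuous_euclidean
  -- the common law of the `Z θ`
  set ν : Measure S := P.map (Z .zero) with hν
  have : IsProbabilityMeasure ν := Measure.isProbabilityMeasure_map (hZm _).aemeasurable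
  have hFs : ∀ x, Measurable (F x) := fun x => hF.comp measurable_prodMk_left
  have hLip' : ∀ x y s, ‖F x s - F y s‖ ≤ C₂ * L * C₁ * ‖x - y‖ := fun x y s =>
    calc ‖F x s - F y s‖ ≤ C₂ * nrm (F x s - F y s) := hle₂ _
      _ ≤ C₂ * (L * (C₁ * ‖x - y‖)) := by
          gcongr
          exact (hLip x y s).trans (by gcongr; exact hle₁ _)
      _ = _ := by ring
  have hM : MemLp (F ξ) 2 ν := by
    rw [hν, memLp_map_measure_iff (hFs ξ).aestronglyMeasurable (hZm _).aemeasurable]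
    have hmeas : Measurable (F ξ ∘ Z .zero) := (hFs ξ).comp (hZm _)
    have h1 : MemLp (fun ω => nrm (F ξ (Z .zero ω))) 2 P :=
      (memLp_two_iff_integrable_sq (hcont.measurable.comp hmeas).aestronglyMeasurable).2 hFint
    refine (h1.const_mul C₂).mono' hmeas.aestronglyMeasurable (.of_forall fun ω => hle₂ _)
  -- extend the exact solution continuously to the real line
  set X' : ℝ → EuclideanSpace ℝ (Fin d) := IccExtend hT ((Icc 0 T).domRestrict X) with hX'
  have hX'c : Continuous X' := hX.domRestrict.Icc_extend'
  have hX'eq : ∀ t ∈ Icc 0 T, X' t = X t := fun t ht => by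
    rw [hX', IccExtend_of_mem hT _ ht]; rfl
  have hsol' : ∀ t ∈ Icc (0 : ℝ) T, X' t = ξ + ∫ r in (0 : ℝ)..t, (∫ s, F (X' r) s ∂ν) := by
    intro t ht
    rw [hX'eq t ht, hsol t ht]
    congr 1
    refine intervalIntegral.integral_congr fun r hr => ?_
    rw [uIcc_of_le ht.1] at hr
    simp only [hX'eq r ⟨hr.1, hr.2.trans ht.2⟩]
    rw [hν, integral_map (hZm _).aemeasurable (hFs _).aestronglyMeasurable]
  obtain ⟨A, κ, hA, hκ, herr⟩ :=
    exists_mlpField_error_bound hF hLip' (by positivity) hM hX'c hT hsol'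
  -- the uniform variables as points of the unit interval
  set R : MLPIndex → Ω → unitInterval := fun θ ω => projIcc 0 1 zero_le_one (𝔯 θ ω) with hRdef
  have hproj : Measurable (projIcc (0 : ℝ) 1 zero_le_one) := continuous_projIcc.measurable
  have hRm : ∀ θ, Measurable (R θ) := fun θ => hproj.comp (h𝔯m θ)
  have hRval : ∀ θ ω, (R θ ω : ℝ) = 𝔯 θ ω := fun θ ω => by
    rw [hRdef]
    simp only [projIcc_of_mem zero_le_one (h𝔯01 θ ω)]
  have hRlaw : ∀ θ, P.map (R θ) = volume := by
    intro θ
    have h1 : P.map (R θ) = (P.map (𝔯 θ)).map (projIcc 0 1 zero_le_one) :=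
      (Measure.map_map hproj (h𝔯m θ)).symm
    rw [h1, h𝔯unif, ← unitInterval.measurePreserving_coe.map_eq,
      Measure.map_map hproj measurable_subtype_coe]
    have h2 : projIcc (0 : ℝ) 1 zero_le_one ∘ (Subtype.val : unitInterval → ℝ) = id := by
      funext r
      exact projIcc_val zero_le_one r
    rw [h2, Measure.map_id]
  have hRindep : iIndepFun R P := h𝔯indep.comp (fun _ => projIcc 0 1 zero_le_one) fun _ => hproj
  have hRZ : IndepFun (fun ω θ => R θ ω) (fun ω θ => Z θ ω) P :=
    h𝔯Z.comp (φ := fun (u : MLPIndex → ℝ) θ => projIcc 0 1 zero_le_one (u θ)) (ψ := id)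
      (measurable_pi_lambda _ fun θ => hproj.comp (measurable_pi_apply θ)) measurable_id
  have hpres := map_shift_noise hZm hZindep (fun θ => (hZident θ .zero).map_eq) hRm hRindep
    hRlaw hRZ .zero
  have hrepr : ∀ m : ℕ, 1 ≤ m → ∀ ω, 𝒳 m m .zero T ω =
      mlpField F ξ m m T (MLPIndex.zero.shift fun p => (R p ω, Z p ω)) := fun m hm ω => by
    refine eq_mlpField_of_recursion (𝒳 := fun n => 𝒳 n m) (fun n θ t ht ω => ?_) m .zero
      ⟨hT, le_rfl⟩ ω
    simp only [hRval]
    exact h𝒳 n m hm θ t ht ω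
  obtain ⟨c, N, hN⟩ := exists_levels δ (C₁ ^ 2 * A + 1) (6 * Real.exp (κ * T)) hδ (by positivity)
    (by positivity)
  refine ⟨c, N, fun ε hε => ?_⟩
  obtain ⟨hN1, hcost, hacc⟩ := hN ε hε
  generalize N ε = n at hN1 hcost hacc
  obtain ⟨hmem, hbound⟩ := herr n hN1 n T ⟨hT, le_rfl⟩
  have hmem' := (hmem.comp_measurePreserving hpres).norm
  have hint' : ∫ ω, ‖mlpField F ξ n n T (MLPIndex.zero.shift fun p => (R p ω, Z p ω)) - X' T‖ ^ 2 ∂P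
      = ∫ w, ‖mlpField F ξ n n T w - X' T‖ ^ 2 ∂noiseMeasure ν := by
    conv_rhs => rw [← hpres.map_eq]
    rw [integral_map hpres.measurable.aemeasurable
      (f := fun w => ‖mlpField F ξ n n T w - X' T‖ ^ 2)]
    rw [hpres.map_eq]
    exact hmem.aestronglyMeasurable.norm.pow 2
  have hle : ∀ ω, nrm (X T - 𝒳 n n .zero T ω) ≤
      C₁ * ‖mlpField F ξ n n T (MLPIndex.zero.shift fun p => (R p ω, Z p ω)) - X' T‖ := fun ω => by
    rw [hX'eq T ⟨hT, le_rfl⟩, ← hrepr n hN1 ω, norm_sub_rev]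
    exact hle₁ _
  have hmeas : AEStronglyMeasurable (fun ω => nrm (X T - 𝒳 n n .zero T ω)) P := by
    have h1 : (fun ω => 𝒳 n n .zero T ω) =
        fun ω => mlpField F ξ n n T (MLPIndex.zero.shift fun p => (R p ω, Z p ω)) :=
      funext (hrepr n hN1)
    have h2 : Measurable fun ω => 𝒳 n n .zero T ω := by
      rw [h1]
      exact (measurable_mlpField ξ n hF n).comp (measurable_const.prodMk hpres.measurable)
    exact (hcont.measurable.comp (measurable_const.sub h2)).aestronglyMeasurable
  have hL2 : MemLp (fun ω => nrm (X T - 𝒳 n n .zero T ω)) 2 P :=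
    (hmem'.const_mul C₁).mono' hmeas (.of_forall fun ω => by
      rw [Real.norm_eq_abs, abs_of_nonneg (apply_nonneg nrm _)]
      exact hle ω)
  refine ⟨hN1, ?_, hL2.integrable_sq, ?_⟩
  · refine le_trans ?_ hcost
    have h1 : mlpRV n n ≤ (4 * n) ^ n := card_mlpIndices_le n hN1 n _
    exact_mod_cast h1
  · have hn0 : (0 : ℝ) < n := by exact_mod_cast hN1
    have h1 : ∫ ω, nrm (X T - 𝒳 n n .zero T ω) ^ 2 ∂P ≤ ε ^ 2 := by
      calc ∫ ω, nrm (X T - 𝒳 n n .zero T ω) ^ 2 ∂P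
          ≤ ∫ ω, C₁ ^ 2 * ‖mlpField F ξ n n T
              (MLPIndex.zero.shift fun p => (R p ω, Z p ω)) - X' T‖ ^ 2 ∂P := by
            refine integral_mono hL2.integrable_sq (hmem'.integrable_sq.const_mul _) fun ω => ?_
            rw [← mul_pow]
            exact pow_le_pow_left₀ (apply_nonneg nrm _) (hle ω) 2
        _ ≤ C₁ ^ 2 * (A * 6 ^ n / n ^ n * Real.exp (κ * n * T)) := by
            rw [integral_const_mul, hint']
            gcongr
        _ = C₁ ^ 2 * A * (6 * Real.exp (κ * T) / n) ^ n := by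
            rw [div_pow, mul_pow, ← Real.exp_nat_mul, show (n : ℝ) * (κ * T) = κ * n * T by ring]
            ring
        _ ≤ (C₁ ^ 2 * A + 1) * (6 * Real.exp (κ * T) / n) ^ n := by gcongr; linarith
        _ ≤ ε ^ 2 := hacc
    rw [← Real.sqrt_eq_rpow]
    exact (Real.sqrt_le_sqrt h1).trans_eq (Real.sqrt_sq hε.1.le)
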